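/- Let $t\in\mathbb R\setminus\{0\}$, $P\in L^2([0,\pi],\mathbb C)$ and $Q=t\,\overline{P}$, and let $v=\begin{pmatrix}0&P\\Q&0\end{pmatrix}$ (the class of these potentials is denoted $X_t$). In $L^2([0,\pi],\mathbb C^2)$ consider the operators $L_{Per^{\pm}}(v)$ given by $$Ly=i\begin{pmatrix}1&0\\0&-1\end{pmatrix}y'+v\,y,$$ with domain the absolutely continuous $y:[0,\pi]\to\mathbb C^2$ such that $y'\in L^2$ and $y(\pi)=\pm y(0)$. For $n\in\mathbb Z$ let $D_n=\{z\in\mathbb C:|z-n|<1/4\}$, and consider $L_{Per^+}(v)$ if $n$ is even and $L_{Per^-}(v)$ if $n$ is odd. Whenever this operator has exactly two eigenvalues in $D_n$, counted with algebraic multiplicity (the dimension of the space of all $y$ with $(L-\lambda)^ky=0$ for some $k\ge 1$), they are denoted $\lambda_n^-,\lambda_n^+$, ordered so that $\operatorname{Re}\lambda_n^-<\operatorname{Re}\lambda_n^+$, or $\operatorname{Re}\lambda_n^-=\operatorname{Re}\lambda_n^+$ and $\operatorname{Im}\lambda_n^-\le\operatorname{Im}\lambda_n^+$. (a) If $t>0$,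 then each of $L_{Per^+}(v)$ and $L_{Per^-}(v)$ is similar (through a bounded, boundedly invertible operator) to a self-adjoint operator, and $\mathrm{Sp}(L_{Per^{\pm}}(v))\subset\mathbb R$. (b) If $t<0$, then there is $N=N(v)$ such that for every $n\in\mathbb Z$ with $|n|>N$ the eigenvalues $\lambda_n^-,\lambda_n^+$ are well defined as above, and either (i) $\lambda_n^-$ and $\lambda_n^+$ are simple (of algebraic multiplicity one), $\overline{\lambda_n^+}=\lambda_n^-$ and $\operatorname{Im}\lambda_n^{\pm}\neq0$, or (ii) $\lambda_n^+=\lambda_n^-$ is real, and it is an eigenvalue of algebraic and geometric multiplicity 2. -/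

import Mathlib

open MeasureTheory Set
open scoped ENNReal

namespace PeriodicDirac

/-! ### Notions for unbounded operators -/

section Unbounded

variable {H : Type*} [NormedAddCommGroup H] [InnerProductSpace ℂ H]

/-- Two partially defined operators are similar: `S = A⁻¹ T A` (equality of domains included) for a
bounded, boundedly invertible operator `A`. -/
def Similar (S T : H →ₗ.[ℂ] H) : Prop :=
  ∃ A : H ≃L[ℂ] H, ∀ x y : H, (x, y) ∈ S.graph ↔ (A x, A y) ∈ T.graph

/-- The resolvent set: those `z` for which `z - T : dom T → H` has a bounded two-sided inverse,
defined on all of `H`. -/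
def resolventSet (T : H →ₗ.[ℂ] H) : Set ℂ :=
  {z | ∃ R : H →L[ℂ] H,
    (∀ x : H, ∃ h : R x ∈ T.domain, z • R x - T ⟨R x, h⟩ = x) ∧
    ∀ y : T.domain, R (z • (y : H) - T y) = y}

/-- The spectrum of an unbounded operator. -/
def spectrum (T : H →ₗ.[ℂ] H) : Set ℂ := (resolventSet T)ᶜ

/-- The kernel of `(T - z)ᵏ`, i.e. the vectors `y` such that `y ∈ dom T` and `(T - z) y` lies in the
kernel of `(T - z)ᵏ⁻¹`. -/
noncomputable def kerPow (T : H →ₗ.[ℂ] H) (z : ℂ) : ℕ → Submodule ℂ H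
  | 0 => ⊥
  | k + 1 => ((kerPow T z k).comap (T.toFun - z • T.domain.subtype)).map T.domain.subtype

/-- The root subspace of `T` at `z`: eigenvectors and associated vectors. -/
noncomputable def rootSubspace (T : H →ₗ.[ℂ] H) (z : ℂ) : Submodule ℂ H := ⨆ k, kerPow T z k

/-- Algebraic multiplicity: the dimension of the root subspace (zero if `z` is not an
eigenvalue). -/
noncomputable def algMult (T : H →ₗ.[ℂ] H) (z : ℂ) : Cardinal := Module.rank ℂ (rootSubspace T z)

/-- Geometric multiplicity: the dimension of the kernel of `T - z`. -/
noncomputable def geomMult (T : H →ₗ.[ℂ] H) (z : ℂ) : Cardinal := Module.rank ℂ (kerPow T z 1)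

end Unbounded

/-! ### The Dirac operators -/

/-- Lebesgue measure on `[0, π]`. -/
noncomputable def intervalMeasure : Measure ℝ := volume.restrict (Icc 0 Real.pi)

instance : IsFiniteMeasure intervalMeasure := by
  unfold intervalMeasure; infer_instance

/-- The space `ℂ²` with its Euclidean norm. -/
abbrev C2 : Type := EuclideanSpace ℂ (Fin 2)

/-- The Hilbert space `L²([0, π], ℂ²)`. -/
abbrev L2 : Type := Lp C2 2 intervalMeasure

/-- A Dirac potential with entries `P, Q ∈ L²([0, π])` off the diagonal. -/
structure Potential where
  P : Lp ℂ 2 intervalMeasure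
  Q : Lp ℂ 2 intervalMeasure

/-- The class `X_t` of the potentials with `Q = t * conj P`. -/
def classX (t : ℝ) : Set Potential :=
  {v | ∀ᵐ x ∂intervalMeasure, v.Q x = (t : ℂ) * (starRingEnd ℂ) (v.P x)}

/-- Periodic and antiperiodic boundary conditions. -/
inductive BC
  | per
  | anti

/-- The sign `σ` in the boundary condition `y(π) = σ y(0)`. -/
def BC.sign : BC → ℂ
  | .per => 1
  | .anti => -1

/-- `y` has an absolutely continuous representative on `[0, π]` with value `c` at `0` and with
derivative `g ∈ L²`. -/
def IsPrimitive (y : L2) (c : C2) (g : L2) : Prop :=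
  ∀ᵐ x ∂intervalMeasure, y x = c + ∫ s in (0 : ℝ)..x, g s

theorem intervalIntegrable_L2 (g : L2) : IntervalIntegrable (g : ℝ → C2) volume 0 Real.pi := by
  have h : Integrable (g : ℝ → C2) intervalMeasure := (Lp.memLp g).integrable (by norm_num)
  rw [intervalIntegrable_iff_integrableOn_Icc_of_le Real.pi_pos.le]
  exact h

theorem intervalIntegrable_L2' (g : L2) {x : ℝ} (hx : x ∈ Icc 0 Real.pi) :
    IntervalIntegrable (g : ℝ → C2) volume 0 x := by
  refine (intervalIntegrable_L2 g).mono_set ?_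
  rw [uIcc_of_le hx.1, uIcc_of_le Real.pi_pos.le]
  exact Icc_subset_Icc_right hx.2

theorem ae_mem_Icc : ∀ᵐ x ∂intervalMeasure, x ∈ Icc 0 Real.pi :=
  ae_restrict_mem measurableSet_Icc

theorem integral_add_L2 (g h : L2) {x : ℝ} (hx : x ∈ Icc 0 Real.pi) :
    ∫ s in (0 : ℝ)..x, (g + h : L2) s = (∫ s in (0 : ℝ)..x, g s) + ∫ s in (0 : ℝ)..x, h s := by
  rw [← intervalIntegral.integral_add (intervalIntegrable_L2' g hx) (intervalIntegrable_L2' h hx)]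
  refine intervalIntegral.integral_congr_ae ?_
  have := Lp.coeFn_add g h
  unfold intervalMeasure at this
  rw [Filter.EventuallyEq, ae_restrict_iff' measurableSet_Icc] at this
  filter_upwards [this] with s hs hsx
  rw [uIoc_of_le hx.1] at hsx
  exact hs ⟨hsx.1.le, hsx.2.trans hx.2⟩

theorem integral_smul_L2 (a : ℂ) (g : L2) {x : ℝ} (hx : x ∈ Icc 0 Real.pi) :
    ∫ s in (0 : ℝ)..x, (a • g : L2) s = a • ∫ s in (0 : ℝ)..x, g s := by
  rw [← intervalIntegral.integral_smul]
  refine intervalIntegral.integral_congr_ae ?_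
  have := Lp.coeFn_smul a g
  unfold intervalMeasure at this
  rw [Filter.EventuallyEq, ae_restrict_iff' measurableSet_Icc] at this
  filter_upwards [this] with s hs hsx
  rw [uIoc_of_le hx.1] at hsx
  exact hs ⟨hsx.1.le, hsx.2.trans hx.2⟩

theorem IsPrimitive.add {y y' : L2} {c c' : C2} {g g' : L2} (h : IsPrimitive y c g)
    (h' : IsPrimitive y' c' g') : IsPrimitive (y + y') (c + c') (g + g') := by
  unfold IsPrimitive at *
  filter_upwards [h, h', Lp.coeFn_add y y', ae_mem_Icc] with x h1 h2 h3 hx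
  rw [h3, Pi.add_apply, h1, h2, integral_add_L2 g g' hx]
  abel

theorem IsPrimitive.smul (a : ℂ) {y : L2} {c : C2} {g : L2} (h : IsPrimitive y c g) :
    IsPrimitive (a • y) (a • c) (a • g) := by
  unfold IsPrimitive at *
  filter_upwards [h, Lp.coeFn_smul a y, ae_mem_Icc] with x h1 h3 hx
  rw [h3, Pi.smul_apply, h1, integral_smul_L2 a g hx, smul_add]

theorem continuousOn_primitive (c : C2) (g : L2) :
    ContinuousOn (fun x => c + ∫ s in (0 : ℝ)..x, g s) (Icc 0 Real.pi) := by
  have h : IntegrableOn (g : ℝ → C2) (uIcc 0 Real.pi) volume := by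
    rw [uIcc_of_le Real.pi_pos.le]
    exact (intervalIntegrable_iff_integrableOn_Icc_of_le Real.pi_pos.le).1
      (intervalIntegrable_L2 g)
  have := intervalIntegral.continuousOn_primitive_interval h
  rw [uIcc_of_le Real.pi_pos.le] at this
  exact continuousOn_const.add this

theorem IsPrimitive.eq_zero {c : C2} {g : L2} (h : IsPrimitive 0 c g) : c = 0 ∧ g = 0 := by
  have hcont := continuousOn_primitive c g
  have hae : (fun x => c + ∫ s in (0 : ℝ)..x, g s) =ᵐ[volume.restrict (Icc 0 Real.pi)]
      fun _ => (0 : C2) := by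
    have h0 : ((0 : L2) : ℝ → C2) =ᵐ[intervalMeasure] 0 := Lp.coeFn_zero ..
    change _ =ᵐ[intervalMeasure] _
    filter_upwards [h, h0] with x h1 h2
    rw [← h1, h2, Pi.zero_apply]
  have hall := Measure.eqOn_Icc_of_ae_eq volume Real.pi_pos.ne hae hcont continuousOn_const
  have hc : c = 0 := by simpa using hall (left_mem_Icc.2 Real.pi_pos.le)
  refine ⟨hc, ?_⟩
  rw [Lp.eq_zero_iff_ae_eq_zero]
  have hd := (intervalIntegrable_L2 g).ae_hasDerivAt_integral
  have hd' : ∀ᵐ x ∂(volume.restrict (Ioo 0 Real.pi)), g x = (0 : C2) := by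
    rw [ae_restrict_iff' measurableSet_Ioo]
    filter_upwards [hd] with x hx hxm
    have hxI : x ∈ uIcc 0 Real.pi := by
      rw [uIcc_of_le Real.pi_pos.le]; exact Ioo_subset_Icc_self hxm
    have h1 := hx hxI 0 left_mem_uIcc
    have h2 : HasDerivAt (fun u => ∫ s in (0 : ℝ)..u, g s) (0 : C2) x := by
      refine (hasDerivAt_const x (0 : C2)).congr_of_eventuallyEq ?_
      filter_upwards [Ioo_mem_nhds hxm.1 hxm.2] with u hu
      simpa [hc] using hall (Ioo_subset_Icc_self hu)
    exact h1.unique h2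
  have hm : intervalMeasure = volume.restrict (Ioo 0 Real.pi) :=
    Measure.restrict_congr_set Ioo_ae_eq_Icc.symm
  change ∀ᵐ x ∂intervalMeasure, g x = (0 : C2)
  rw [← hm] at hd'
  exact hd'

theorem IsPrimitive.unique {y : L2} {c c' : C2} {g g' : L2} (h : IsPrimitive y c g)
    (h' : IsPrimitive y c' g') : c = c' ∧ g = g' := by
  have := h.add (h'.smul (-1))
  rw [neg_one_smul, add_neg_cancel] at this
  obtain ⟨h1, h2⟩ := this.eq_zero
  rw [neg_one_smul] at h1 h2
  exact ⟨add_neg_eq_zero.1 h1, add_neg_eq_zero.1 h2⟩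

/-- The domain of the operators: `y` is absolutely continuous on `[0, π]`, `y' ∈ L²`, and
`y(π) = σ y(0)`. -/
def domain (bc : BC) : Submodule ℂ L2 where
  carrier := {y | ∃ (c : C2) (g : L2), IsPrimitive y c g ∧
    c + ∫ s in (0 : ℝ)..Real.pi, g s = bc.sign • c}
  add_mem' := by
    rintro y y' ⟨c, g, h, hb⟩ ⟨c', g', h', hb'⟩
    refine ⟨c + c', g + g', h.add h', ?_⟩
    rw [integral_add_L2 g g' (right_mem_Icc.2 Real.pi_pos.le), smul_add, ← hb, ← hb']
    abel
  zero_mem' := by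
    refine ⟨0, 0, ?_, ?_⟩
    · simpa using IsPrimitive.smul (0 : ℂ) (y := 0) (c := 0) (g := 0) (by
        have h0 : ((0 : L2) : ℝ → C2) =ᵐ[intervalMeasure] 0 := Lp.coeFn_zero ..
        unfold IsPrimitive
        filter_upwards [h0, ae_mem_Icc] with x hx hxm
        have := integral_smul_L2 0 0 hxm
        rw [zero_smul, zero_smul] at this
        rw [this, hx]; simp)
    · have := integral_smul_L2 0 0 (right_mem_Icc.2 Real.pi_pos.le)
      rw [zero_smul, zero_smul] at this
      rw [this]; simp
  smul_mem' := by
    rintro a y ⟨c, g, h, hb⟩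
    refine ⟨a • c, a • g, h.smul a, ?_⟩
    rw [integral_smul_L2 a g (right_mem_Icc.2 Real.pi_pos.le), ← smul_add, hb, smul_comm]

/-- The derivative `y' ∈ L²` of an element of the domain. -/
noncomputable def derivative {bc : BC} (y : domain bc) : L2 := y.2.choose_spec.choose

theorem isPrimitive_derivative {bc : BC} (y : domain bc) :
    ∃ c, IsPrimitive (y : L2) c (derivative y) :=
  ⟨_, y.2.choose_spec.choose_spec.1⟩

theorem derivative_eq {bc : BC} (y : domain bc) {c : C2} {g : L2}
    (h : IsPrimitive (y : L2) c g) : derivative y = g := by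
  obtain ⟨c', h'⟩ := isPrimitive_derivative y
  exact (h'.unique h).2

theorem derivative_add {bc : BC} (y y' : domain bc) :
    derivative (y + y') = derivative y + derivative y' := by
  obtain ⟨c, h⟩ := isPrimitive_derivative y
  obtain ⟨c', h'⟩ := isPrimitive_derivative y'
  exact derivative_eq _ (h.add h')

theorem derivative_smul {bc : BC} (a : ℂ) (y : domain bc) :
    derivative (a • y) = a • derivative y := by
  obtain ⟨c, h⟩ := isPrimitive_derivative y
  exact derivative_eq _ (h.smul a)

/-- The differential expression `i diag(1, -1) g + v y`, where `g` is the derivative of `y`. -/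
noncomputable def diracExpr (v : Potential) (y g : L2) (x : ℝ) : C2 :=
  !₂[Complex.I * g x 0 + v.P x * y x 1, -(Complex.I * g x 1) + v.Q x * y x 0]

theorem memLp_coord (y : L2) (i : Fin 2) : MemLp (fun x => y x i) 2 intervalMeasure :=
  (EuclideanSpace.proj i : C2 →L[ℂ] ℂ).comp_memLp' (Lp.memLp y)

theorem IsPrimitive.bounded {y : L2} {c : C2} {g : L2} (h : IsPrimitive y c g) :
    ∃ C : ℝ, ∀ᵐ x ∂intervalMeasure, ‖y x‖ ≤ C := by
  have hcont := continuousOn_primitive c g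
  obtain ⟨C, hC⟩ := isCompact_Icc.exists_bound_of_continuousOn hcont
  refine ⟨C, ?_⟩
  filter_upwards [h, ae_mem_Icc] with x hx hxm
  rw [hx]; exact hC x hxm

theorem IsPrimitive.memLp_mul {y : L2} {c : C2} {g : L2} (h : IsPrimitive y c g)
    (p : Lp ℂ 2 intervalMeasure) (i : Fin 2) :
    MemLp (fun x => p x * y x i) 2 intervalMeasure := by
  obtain ⟨C, hC⟩ := h.bounded
  have hb : MemLp (fun x => y x i) ∞ intervalMeasure := by
    refine memLp_top_of_bound (memLp_coord y i).1 C ?_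
    filter_upwards [hC] with x hx
    exact (PiLp.norm_apply_le (y x) i).trans hx
  exact hb.mul (Lp.memLp p)

theorem memLp_diracExpr (v : Potential) {y : L2} {c : C2} {g : L2} (h : IsPrimitive y c g) :
    MemLp (diracExpr v y g) 2 intervalMeasure := by
  refine MemLp.of_eval_piLp fun i => ?_
  fin_cases i
  · simpa [diracExpr] using! ((memLp_coord g 0).const_mul Complex.I).add (h.memLp_mul v.P 1)
  · simpa [diracExpr] using! ((memLp_coord g 1).const_mul Complex.I).neg.add (h.memLp_mul v.Q 0)

theorem memLp_diracExpr_derivative (v : Potential) {bc : BC} (y : domain bc) :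
    MemLp (diracExpr v y (derivative y)) 2 intervalMeasure :=
  memLp_diracExpr v (isPrimitive_derivative y).choose_spec

/-- The Dirac operator `L y = i diag(1, -1) y' + v y` on `[0, π]` with the boundary condition
`bc`, as an unbounded operator in `L²([0, π], ℂ²)`. -/
noncomputable def diracOp (bc : BC) (v : Potential) : L2 →ₗ.[ℂ] L2 where
  domain := domain bc
  toFun :=
    { toFun := fun y => (memLp_diracExpr_derivative v y).toLp _
      map_add' := by
        intro y y'
        rw [← MemLp.toLp_add, MemLp.toLp_eq_toLp_iff]
        rw [derivative_add]
        filter_upwards [Lp.coeFn_add (y : L2) y', Lp.coeFn_add (derivative y) (derivative y')]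
          with x h1 h2
        rw [Pi.add_apply] at h1 h2
        rw [Pi.add_apply]
        unfold diracExpr
        rw [Submodule.coe_add, h1, h2]
        ext i
        fin_cases i <;> simp <;> ring
      map_smul' := by
        intro a y
        rw [RingHom.id_apply, ← MemLp.toLp_const_smul, MemLp.toLp_eq_toLp_iff]
        rw [derivative_smul]
        filter_upwards [Lp.coeFn_smul a (y : L2), Lp.coeFn_smul a (derivative y)] with x h1 h2
        rw [Pi.smul_apply] at h1 h2
        rw [Pi.smul_apply]
        unfold diracExpr
        rw [Submodule.coe_smul, h1, h2]
        ext i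
        fin_cases i <;> simp <;> ring }

/-! ### The eigenvalues close to an integer -/

/-- The boundary condition attached to `n`: periodic for even `n`, antiperiodic for odd `n`. -/
def bcOf (n : ℤ) : BC := if Even n then .per else .anti

open Classical in
/-- `lm` and `lp` are the numbers `λ_n⁻` and `λ_n⁺`: in the disc `|z - n| < 1/4` the operator has
exactly two eigenvalues `lm, lp` counted with algebraic multiplicity, ordered by real part and, if
the real parts agree, by imaginary part. -/
def IsEigenPair (v : Potential) (n : ℤ) (lm lp : ℂ) : Prop :=
  lm ∈ Metric.ball (n : ℂ) (1 / 4) ∧ lp ∈ Metric.ball (n : ℂ) (1 / 4) ∧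
  (∀ z ∈ Metric.ball (n : ℂ) (1 / 4),
    algMult (diracOp (bcOf n) v) z = (Multiset.count z {lm, lp} : ℕ)) ∧
  (lm.re < lp.re ∨ lm.re = lp.re ∧ lm.im ≤ lp.im)

end PeriodicDirac

/-!
All arguments are phrased in terms of graphs of unbounded operators. `(y, f)` lies in the graph of
the Dirac operator iff `y` has an absolutely continuous representative satisfying the boundary
condition, whose derivative gives `f` almost everywhere (`mem_graph_iff`). Integration by parts
rests on the product rule `HasPrim.mul`.

For `t > 0`, conjugation by the constant matrix `diag(√t, 1)` replaces `(P, t conj P)` by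
`(√t P, √t conj P)`, whose Dirac operator is symmetric (`similar_selfAdjoint`). A symmetric operator
is self-adjoint as soon as its resolvent set contains all points far from the real axis
(`IsSymm.isSelfAdjoint`). This holds here because the free resolvent maps `L²` to `L^∞` with norm
of order `|im z|^(-1/2)`, so that an `L²` potential is a small relative perturbation of the free
operator `L⁰` when `|im z|` is large (`norm_sq_sub_le_resolvent`).

For `t < 0`, the first step holds for all `L²` potentials: two eigenvalues lie near each large
integer `n`. Fix a large `τ` and put `z = n + iτ`. The difference of the resolvents of `L` and `L⁰`
at `z` is controlled by `(L⁰ - z)⁻¹ V (L⁰ - z)⁻¹`, which tends to zero as `|n| → ∞`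
(`eventually_sandwich_small`): since `V` anticommutes with `diag(1, -1)`, an absolutely continuous
periodic potential gains a factor `1 / |z|`, and these potentials are dense in `L²`. The eigenvalue
`n` of `L⁰` is isolated with a gap independent of `n` (`freeOp_gap`, from a Poincaré inequality),
and its eigenspace is two-dimensional. No contour integrals are needed to follow this eigenspace under the perturbation:
the perturbed invariant subspace is the graph of a small operator solving a Riccati equation
(`exists_invariant_graph`, `exists_invariant_subspace`). Near `n` the root subspaces of `L` are
those of a `2 × 2` matrix (`algMult_eq_rootMultiplicity`), whose characteristic polynomial has two
roots.

The second step uses the antilinear map `J (y₀, y₁) = (conj y₁, t conj y₀)`, which commutes with the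
operator and satisfies `J² = t < 0` (`conjMap_mem_graph`, `conjMap_conjMap`). So the eigenvalues
near `n` come in conjugate pairs. A vector with `J y = a y` would give `|a|² = t`; hence a real eigenvalue
has geometric multiplicity at least two (`two_le_geomMult`) and exhausts the two eigenvalues near
`n`. The two cases of the dichotomy remain (`IsEigenPair.dichotomy`).
-/

namespace PeriodicDirac

/-! ### Absolutely continuous functions on `[0, π]` -/

/-- `u` is absolutely continuous on `[0, π]` with derivative `g`, encoded as `u` being an indefinite
integral of `g` there. Values of `u` outside `[0, π]` are unconstrained. -/
structure HasPrim (u g : ℝ → ℂ) : Prop where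
  integrable : Integrable g intervalMeasure
  eq : ∀ x ∈ Icc 0 Real.pi, u x = u 0 + ∫ s in (0 : ℝ)..x, g s

theorem intervalIntegrable_of_integrable {E : Type*} [NormedAddCommGroup E] {g : ℝ → E}
    (h : Integrable g intervalMeasure) : IntervalIntegrable g volume 0 Real.pi := by
  rw [intervalIntegrable_iff_integrableOn_Icc_of_le Real.pi_pos.le]
  exact h

theorem intervalIntegrable_of_integrable' {E : Type*} [NormedAddCommGroup E] {g : ℝ → E}
    (h : Integrable g intervalMeasure) {a b : ℝ} (ha : a ∈ Icc 0 Real.pi)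
    (hb : b ∈ Icc 0 Real.pi) : IntervalIntegrable g volume a b := by
  refine (intervalIntegrable_of_integrable h).mono_set ?_
  rw [uIcc_of_le Real.pi_pos.le]
  exact uIcc_subset_Icc ha hb

theorem integral_intervalMeasure {E : Type*} [NormedAddCommGroup E] [NormedSpace ℝ E]
    (g : ℝ → E) : ∫ x, g x ∂intervalMeasure = ∫ x in (0 : ℝ)..Real.pi, g x := by
  rw [intervalIntegral.integral_of_le Real.pi_pos.le, ← integral_Icc_eq_integral_Ioc]
  rfl

theorem ae_intervalMeasure_iff {p : ℝ → Prop} :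
    (∀ᵐ x ∂intervalMeasure, p x) ↔ ∀ᵐ x, x ∈ Icc 0 Real.pi → p x :=
  ae_restrict_iff' measurableSet_Icc

theorem intervalIntegral_congr_ae {E : Type*} [NormedAddCommGroup E] [NormedSpace ℝ E]
    {g h : ℝ → E} (hgh : g =ᵐ[intervalMeasure] h) {x : ℝ} (hx : x ∈ Icc 0 Real.pi) :
    ∫ s in (0 : ℝ)..x, g s = ∫ s in (0 : ℝ)..x, h s := by
  refine intervalIntegral.integral_congr_ae ?_
  have := ae_intervalMeasure_iff.1 hgh
  filter_upwards [this] with s hs hsx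
  rw [uIoc_of_le hx.1] at hsx
  exact hs ⟨hsx.1.le, hsx.2.trans hx.2⟩

theorem ContinuousOn.integrable_intervalMeasure {E : Type*} [NormedAddCommGroup E] {u : ℝ → E}
    (h : ContinuousOn u (Icc 0 Real.pi)) : Integrable u intervalMeasure :=
  h.integrableOn_Icc

theorem absolutelyContinuous_congr {E : Type*} [NormedAddCommGroup E] {u w : ℝ → E} {a b : ℝ}
    (hu : AbsolutelyContinuousOnInterval u a b) (huw : ∀ x ∈ uIcc a b, u x = w x) :
    AbsolutelyContinuousOnInterval w a b := by
  rw [absolutelyContinuousOnInterval_iff] at hu ⊢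
  intro ε hε
  obtain ⟨δ, hδ, h⟩ := hu ε hε
  refine ⟨δ, hδ, fun I hI hlen => ?_⟩
  convert! h I hI hlen using 1
  refine Finset.sum_congr rfl fun i hi => ?_
  rw [huw _ (hI.1 i hi).1, huw _ (hI.1 i hi).2]

/-- A primitive of an integrable complex function is absolutely continuous. -/
theorem absolutelyContinuous_primitive {g : ℝ → ℂ} (h : Integrable g intervalMeasure) :
    AbsolutelyContinuousOnInterval (fun x => ∫ s in (0 : ℝ)..x, g s) 0 Real.pi := by
  have hconst (c : ℂ) : AbsolutelyContinuousOnInterval (fun _ : ℝ => c) 0 Real.pi := by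
    refine LipschitzOnWith.absolutelyContinuousOnInterval (K := 0) ?_
    exact (LipschitzWith.const c).lipschitzOnWith
  have hre :=
    (intervalIntegrable_of_integrable h.re).absolutelyContinuousOnInterval_intervalIntegral (c := 0) left_mem_uIcc
  have him :=
    (intervalIntegrable_of_integrable h.im).absolutelyContinuousOnInterval_intervalIntegral (c := 0) left_mem_uIcc
  have key := (hre.smul (hconst 1)).add (him.smul (hconst Complex.I))
  refine absolutelyContinuous_congr key ?_
  intro x hx
  rw [uIcc_of_le Real.pi_pos.le] at hx
  have hi := intervalIntegrable_of_integrable' h (left_mem_Icc.2 Real.pi_pos.le) hx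
  have hre' := (Complex.reCLM).intervalIntegral_comp_comm hi
  have him' := (Complex.imCLM).intervalIntegral_comp_comm hi
  simp only [Complex.reCLM_apply, Complex.imCLM_apply] at hre' him'
  simp only [Pi.add_apply, Pi.smul_apply', RCLike.re_to_complex, RCLike.im_to_complex]
  rw [hre', him', Complex.real_smul, Complex.real_smul, mul_one, Complex.re_add_im]

namespace HasPrim

variable {u w g h : ℝ → ℂ}

theorem ac (H : HasPrim u g) : AbsolutelyContinuousOnInterval u 0 Real.pi := by
  have hconst : AbsolutelyContinuousOnInterval (fun _ : ℝ => u 0) 0 Real.pi := by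
    refine LipschitzOnWith.absolutelyContinuousOnInterval (K := 0) ?_
    exact (LipschitzWith.const _).lipschitzOnWith
  refine absolutelyContinuous_congr (hconst.add (absolutelyContinuous_primitive H.integrable)) ?_
  intro x hx
  rw [uIcc_of_le Real.pi_pos.le] at hx
  exact (H.eq x hx).symm

theorem continuousOn (H : HasPrim u g) : ContinuousOn u (Icc 0 Real.pi) := by
  have := H.ac.continuousOn
  rwa [uIcc_of_le Real.pi_pos.le] at this

theorem ae_hasDerivAt (H : HasPrim u g) :
    ∀ᵐ x, x ∈ uIcc 0 Real.pi → HasDerivAt u (g x) x := by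
  have h0 : ∀ᵐ x : ℝ, x ≠ 0 := by simp [ae_iff, measure_singleton]
  have hpi : ∀ᵐ x : ℝ, x ≠ Real.pi := by simp [ae_iff, measure_singleton]
  filter_upwards [(intervalIntegrable_of_integrable H.integrable).ae_hasDerivAt_integral, h0, hpi]
    with x hx hx0 hxpi hxm
  have h1 := (hx hxm 0 left_mem_uIcc).const_add (u 0)
  refine h1.congr_of_eventuallyEq ?_
  rw [uIcc_of_le Real.pi_pos.le] at hxm
  filter_upwards [Icc_mem_nhds (lt_of_le_of_ne hxm.1 hx0.symm) (lt_of_le_of_ne hxm.2 hxpi)]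
    with y hy
  exact H.eq y hy

theorem of_ac (hu : AbsolutelyContinuousOnInterval u 0 Real.pi) (hg : Integrable g intervalMeasure)
    (hd : ∀ᵐ x, x ∈ uIcc 0 Real.pi → HasDerivAt u (g x) x) : HasPrim u g := by
  refine ⟨hg, ?_⟩
  have h1 := hu.sub (absolutelyContinuous_primitive hg)
  have h2 : ∀ᵐ x, x ∈ uIcc 0 Real.pi →
      HasDerivAt (u - fun x => ∫ s in (0 : ℝ)..x, g s) 0 x := by
    filter_upwards [hd, (intervalIntegrable_of_integrable hg).ae_hasDerivAt_integral]
      with x hx hx' hxm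
    simpa using (hx hxm).sub (hx' hxm 0 left_mem_uIcc)
  obtain ⟨C, hC⟩ := h1.const_of_ae_hasDerivAt_zero h2
  intro x hx
  have e0 := hC 0 left_mem_uIcc
  have e1 := hC x (by rwa [uIcc_of_le Real.pi_pos.le])
  simp only [Pi.sub_apply, intervalIntegral.integral_same, sub_zero] at e0 e1
  rw [e0, ← e1]; ring

theorem mul (H : HasPrim u g) (H' : HasPrim w h) :
    HasPrim (fun x => u x * w x) (fun x => g x * w x + u x * h x) := by
  have hac : AbsolutelyContinuousOnInterval (u • w) 0 Real.pi := H.ac.smul H'.ac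
  refine of_ac hac ?_ ?_
  · refine Integrable.add ?_ ?_
    · have := (intervalIntegrable_of_integrable H.integrable).mul_continuousOn H'.ac.continuousOn
      rwa [intervalIntegrable_iff_integrableOn_Icc_of_le Real.pi_pos.le] at this
    · have := (intervalIntegrable_of_integrable H'.integrable).continuousOn_mul H.ac.continuousOn
      rwa [intervalIntegrable_iff_integrableOn_Icc_of_le Real.pi_pos.le] at this
  · filter_upwards [H.ae_hasDerivAt, H'.ae_hasDerivAt] with x h1 h2 hx
    exact (h1 hx).mul (h2 hx)

theorem congr_deriv (H : HasPrim u g) (hgh : g =ᵐ[intervalMeasure] h) : HasPrim u h :=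
  ⟨H.integrable.congr hgh, fun x hx => by rw [H.eq x hx, intervalIntegral_congr_ae hgh hx]⟩

theorem const_mul (c : ℂ) (H : HasPrim u g) :
    HasPrim (fun x => c * u x) (fun x => c * g x) := by
  refine ⟨H.integrable.const_mul c, fun x hx => ?_⟩
  rw [intervalIntegral.integral_const_mul, H.eq x hx]
  ring

theorem conj (H : HasPrim u g) :
    HasPrim (fun x => (starRingEnd ℂ) (u x)) (fun x => (starRingEnd ℂ) (g x)) := by
  refine ⟨(Complex.conjCLE : ℂ →L[ℝ] ℂ).integrable_comp H.integrable, fun x hx => ?_⟩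
  have := (Complex.conjCLE : ℂ →L[ℝ] ℂ).intervalIntegral_comp_comm
    (intervalIntegrable_of_integrable' H.integrable (left_mem_Icc.2 Real.pi_pos.le) hx)
  simp only [ContinuousLinearEquiv.coe_coe, Complex.conjCLE_apply] at this
  rw [this, H.eq x hx, map_add]

theorem integral_eq (H : HasPrim u g) : ∫ x, g x ∂intervalMeasure = u Real.pi - u 0 := by
  rw [integral_intervalMeasure, H.eq _ (right_mem_Icc.2 Real.pi_pos.le)]
  ring

theorem of_primitive (hg : Integrable g intervalMeasure) (c : ℂ) :
    HasPrim (fun x => c + ∫ s in (0 : ℝ)..x, g s) g :=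
  ⟨hg, fun x _ => by simp⟩

theorem of_hasDerivAt (hd : ∀ x, HasDerivAt u (g x) x) (hg : Continuous g) : HasPrim u g := by
  refine ⟨ContinuousOn.integrable_intervalMeasure hg.continuousOn, fun x _ => ?_⟩
  rw [intervalIntegral.integral_eq_sub_of_hasDerivAt (fun y _ => hd y)
    (hg.intervalIntegrable 0 x)]
  ring

theorem exp (a : ℂ) :
    HasPrim (fun x : ℝ => Complex.exp (a * x)) (fun x : ℝ => a * Complex.exp (a * x)) := by
  refine of_hasDerivAt (fun x => ?_) (by fun_prop)
  have h1 : HasDerivAt (fun y : ℝ => a * (y : ℂ)) a x := by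
    simpa using (Complex.ofRealCLM.hasDerivAt (x := x)).const_mul a
  simpa [mul_comm] using h1.cexp

/-- An absolutely continuous function is essentially bounded. -/
theorem memLp_top (H : HasPrim u g) : MemLp u ∞ intervalMeasure := by
  obtain ⟨C, hC⟩ := isCompact_Icc.exists_bound_of_continuousOn H.continuousOn
  refine memLp_top_of_bound
    (ContinuousOn.integrable_intervalMeasure H.continuousOn).aestronglyMeasurable C ?_
  filter_upwards [ae_mem_Icc] with x hx using hC x hx

theorem memLp_two (H : HasPrim u g) : MemLp u 2 intervalMeasure :=
  H.memLp_top.mono_exponent le_top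

/-- The solution of `i u' - z u = f` with initial value `c`. -/
theorem exists_solution (z c : ℂ) {f : ℝ → ℂ} (hf : Integrable f intervalMeasure) :
    ∃ u : ℝ → ℂ, HasPrim u (fun x => -Complex.I * (z * u x + f x)) ∧ u 0 = c ∧
      u Real.pi = Complex.exp (-Complex.I * z * Real.pi) *
        (c - Complex.I * ∫ x, Complex.exp (Complex.I * z * x) * f x ∂intervalMeasure) := by
  have hef : Integrable (fun x : ℝ => Complex.exp (Complex.I * z * x) * f x) intervalMeasure := by
    have := (intervalIntegrable_of_integrable hf).continuousOn_mul
      (g := fun x : ℝ => Complex.exp (Complex.I * z * x)) (by fun_prop)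
    rwa [intervalIntegrable_iff_integrableOn_Icc_of_le Real.pi_pos.le] at this
  have h1 := of_primitive (hef.const_mul (-Complex.I)) c
  have h2 := (exp (-Complex.I * z)).mul h1
  refine ⟨_, h2.congr_deriv (Filter.Eventually.of_forall fun x => ?_), by simp, ?_⟩
  · have : Complex.exp (-Complex.I * z * x) * Complex.exp (Complex.I * z * x) = 1 := by
      rw [← Complex.exp_add]; ring_nf; simp
    simp only
    linear_combination (-Complex.I * f x) * this
  · rw [intervalIntegral.integral_const_mul, ← integral_intervalMeasure]
    ring

end HasPrim

/-! ### Coordinates in `L²([0, π], ℂ²)` and the graph of the Dirac operator -/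

/-- The element of `L²([0, π], ℂ²)` with the coordinate functions `w 0`, `w 1`. -/
noncomputable def ofCoord (w : Fin 2 → ℝ → ℂ) (h : ∀ i, MemLp (w i) 2 intervalMeasure) : L2 :=
  (MemLp.of_eval_piLp (f := fun x => (WithLp.toLp 2 fun i => w i x : C2)) h).toLp _

theorem ofCoord_ae (w : Fin 2 → ℝ → ℂ) (h : ∀ i, MemLp (w i) 2 intervalMeasure) :
    ∀ᵐ x ∂intervalMeasure, ∀ i, ofCoord w h x i = w i x := by
  filter_upwards [MemLp.coeFn_toLp (MemLp.of_eval_piLp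
    (f := fun x => (WithLp.toLp 2 fun i => w i x : C2)) h)] with x hx i
  rw [ofCoord, hx]

theorem ext_coord {y w : L2} (h : ∀ i, ∀ᵐ x ∂intervalMeasure, y x i = w x i) : y = w := by
  refine Lp.ext ?_
  filter_upwards [ae_all_iff.2 h] with x hx
  ext i
  exact hx i

theorem coord_add (y w : L2) : ∀ᵐ x ∂intervalMeasure, ∀ i, (y + w) x i = y x i + w x i := by
  filter_upwards [Lp.coeFn_add y w] with x hx i
  rw [hx]; rfl

theorem coord_sub (y w : L2) : ∀ᵐ x ∂intervalMeasure, ∀ i, (y - w) x i = y x i - w x i := by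
  filter_upwards [Lp.coeFn_sub y w] with x hx i
  rw [hx]; rfl

theorem coord_smul (a : ℂ) (y : L2) : ∀ᵐ x ∂intervalMeasure, ∀ i, (a • y) x i = a * y x i := by
  filter_upwards [Lp.coeFn_smul a y] with x hx i
  rw [hx]; rfl

theorem integral_coord {g : ℝ → C2} (hg : Integrable g intervalMeasure) {x : ℝ}
    (hx : x ∈ Icc 0 Real.pi) (i : Fin 2) :
    (∫ s in (0 : ℝ)..x, g s) i = ∫ s in (0 : ℝ)..x, g s i :=
  ((EuclideanSpace.proj i : C2 →L[ℂ] ℂ).intervalIntegral_comp_comm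
    (intervalIntegrable_of_integrable' hg (left_mem_Icc.2 Real.pi_pos.le) hx)).symm

theorem integrable_L2 (y : L2) : Integrable y intervalMeasure :=
  (Lp.memLp y).integrable (by norm_num)

/-- `u` is the absolutely continuous representative of `y ∈ L²([0, π], ℂ²)`, it has the derivative
`g ∈ L²`, and it satisfies the boundary condition. -/
structure Rep (bc : BC) (y : L2) (u g : Fin 2 → ℝ → ℂ) : Prop where
  prim : ∀ i, HasPrim (u i) (g i)
  memLp : ∀ i, MemLp (g i) 2 intervalMeasure
  boundary : ∀ i, u i Real.pi = bc.sign * u i 0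
  ae_eq : ∀ i, ∀ᵐ x ∂intervalMeasure, y x i = u i x

theorem exists_rep {bc : BC} {y : L2} (hy : y ∈ domain bc) : ∃ u g, Rep bc y u g := by
  obtain ⟨c, g, h, hb⟩ := hy
  have hint (i : Fin 2) : Integrable (fun x => g x i) intervalMeasure :=
    (memLp_coord g i).integrable (by norm_num)
  refine ⟨fun i x => c i + ∫ s in (0 : ℝ)..x, g s i, fun i x => g x i,
    fun i => HasPrim.of_primitive (hint i) _, fun i => memLp_coord g i, fun i => ?_, fun i => ?_⟩
  · have := congrArg (fun w : C2 => w i) hb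
    simp only [PiLp.add_apply, PiLp.smul_apply, smul_eq_mul] at this
    rw [integral_coord (integrable_L2 g) (right_mem_Icc.2 Real.pi_pos.le)] at this
    simpa using this
  · filter_upwards [h, ae_mem_Icc] with x hx hxm
    rw [hx, PiLp.add_apply, integral_coord (integrable_L2 g) hxm]

namespace Rep

variable {bc : BC} {y : L2} {u g : Fin 2 → ℝ → ℂ}

theorem isPrimitive (H : Rep bc y u g) :
    IsPrimitive y (WithLp.toLp 2 fun i => u i 0) (ofCoord g H.memLp) := by
  filter_upwards [ae_all_iff.2 H.ae_eq, ae_mem_Icc] with x hx hxm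
  ext i
  rw [hx i, PiLp.add_apply, integral_coord (integrable_L2 _) hxm, (H.prim i).eq x hxm]
  congr 1
  refine intervalIntegral_congr_ae ?_ hxm
  filter_upwards [ofCoord_ae g H.memLp] with s hs using (hs i).symm

theorem mem_domain (H : Rep bc y u g) : y ∈ domain bc := by
  refine ⟨_, _, H.isPrimitive, ?_⟩
  ext i
  rw [PiLp.add_apply, integral_coord (integrable_L2 _) (right_mem_Icc.2 Real.pi_pos.le),
    PiLp.smul_apply, smul_eq_mul, ← H.boundary i,
    (H.prim i).eq _ (right_mem_Icc.2 Real.pi_pos.le)]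
  congr 1
  refine intervalIntegral_congr_ae ?_ (right_mem_Icc.2 Real.pi_pos.le)
  filter_upwards [ofCoord_ae g H.memLp] with s hs using hs i

theorem diracOp_ae (H : Rep bc y u g) (v : Potential) (hy : y ∈ (diracOp bc v).domain) :
    ∀ᵐ x ∂intervalMeasure,
      (diracOp bc v ⟨y, hy⟩ : L2) x 0 = Complex.I * g 0 x + v.P x * u 1 x ∧
      (diracOp bc v ⟨y, hy⟩ : L2) x 1 = -(Complex.I * g 1 x) + v.Q x * u 0 x := by
  have hd : derivative (bc := bc) ⟨y, hy⟩ = ofCoord g H.memLp := derivative_eq _ H.isPrimitive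
  filter_upwards [MemLp.coeFn_toLp (memLp_diracExpr_derivative v (bc := bc) ⟨y, hy⟩),
    ofCoord_ae g H.memLp, ae_all_iff.2 H.ae_eq] with x hx hgx hux
  change (MemLp.toLp _ (memLp_diracExpr_derivative v (bc := bc) ⟨y, hy⟩) : L2) x 0 = _ ∧
    (MemLp.toLp _ (memLp_diracExpr_derivative v (bc := bc) ⟨y, hy⟩) : L2) x 1 = _
  rw [hx]
  simp [diracExpr, hd, hgx, hux]

end Rep

/-- `u`, `g` witness that `y` lies in the domain and that `L y = f`. -/
structure GraphRep (bc : BC) (v : Potential) (y f : L2) (u g : Fin 2 → ℝ → ℂ) : Prop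
    extends Rep bc y u g where
  fst : ∀ᵐ x ∂intervalMeasure, f x 0 = Complex.I * g 0 x + v.P x * u 1 x
  snd : ∀ᵐ x ∂intervalMeasure, f x 1 = -(Complex.I * g 1 x) + v.Q x * u 0 x

theorem mem_graph_iff {bc : BC} {v : Potential} {y f : L2} :
    (y, f) ∈ (diracOp bc v).graph ↔ ∃ u g, GraphRep bc v y f u g := by
  rw [LinearPMap.mem_graph_iff]
  constructor
  · rintro ⟨⟨y', hy'⟩, rfl, hf⟩
    obtain ⟨u, g, H⟩ := exists_rep hy'
    have h := H.diracOp_ae v hy'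
    simp only at hf
    rw [hf] at h
    exact ⟨u, g, H, h.mono fun x hx => hx.1, h.mono fun x hx => hx.2⟩
  · rintro ⟨u, g, H⟩
    refine ⟨⟨y, H.mem_domain⟩, rfl, ?_⟩
    refine ext_coord fun i => ?_
    have h := H.diracOp_ae v H.mem_domain
    fin_cases i
    · filter_upwards [h, H.fst] with x hx hf using hx.1.trans hf.symm
    · filter_upwards [h, H.snd] with x hx hf using hx.2.trans hf.symm

/-! ### Resolvents of unbounded operators -/

section Abstract

variable {H : Type*} [NormedAddCommGroup H] [InnerProductSpace ℂ H]

/-- `R` is the bounded two-sided inverse of `T - z`, expressed through the graph of `T`. -/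
def IsInverse (T : H →ₗ.[ℂ] H) (z : ℂ) (R : H →L[ℂ] H) : Prop :=
  ∀ y f : H, (y, f) ∈ T.graph ↔ R (f - z • y) = y

theorem IsInverse.mem_graph {T : H →ₗ.[ℂ] H} {z : ℂ} {R : H →L[ℂ] H} (hR : IsInverse T z R)
    (f : H) : (R f, f + z • R f) ∈ T.graph := by
  rw [hR]; simp

theorem IsInverse.mem_resolventSet {T : H →ₗ.[ℂ] H} {z : ℂ} {R : H →L[ℂ] H}
    (hR : IsInverse T z R) : z ∈ resolventSet T := by
  refine ⟨-R, fun x => ?_, fun y => ?_⟩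
  · have h1 := hR.mem_graph (-x)
    obtain ⟨⟨y, hy⟩, hy1, hy2⟩ := (LinearPMap.mem_graph_iff T).1 h1
    simp only [map_neg] at hy1
    subst hy1
    refine ⟨hy, ?_⟩
    change z • (-R x) - T ⟨-R x, hy⟩ = x
    simp only [map_neg] at hy2
    rw [hy2]; abel
  · have h1 := (hR _ _).1 (T.mem_graph y)
    have : z • (y : H) - T y = -(T y - z • (y : H)) := by abel
    rw [this]
    simpa using h1

theorem IsInverse.of_similar {S T : H →ₗ.[ℂ] H} {z : ℂ} {R : H →L[ℂ] H} (A : H ≃L[ℂ] H)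
    (hA : ∀ x y : H, (x, y) ∈ S.graph ↔ (A x, A y) ∈ T.graph) (hR : IsInverse T z R) :
    IsInverse S z ((A.symm : H →L[ℂ] H) ∘L R ∘L (A : H →L[ℂ] H)) := by
  intro y f
  rw [hA, hR]
  simp only [ContinuousLinearMap.comp_apply, ContinuousLinearEquiv.coe_coe, map_sub, map_smul]
  rw [← map_smul A.symm, ← map_sub A.symm, ContinuousLinearEquiv.symm_apply_eq]

/-- A bijection `T - z` that is bounded below has a bounded inverse. -/
theorem exists_isInverse_of_bound {T : H →ₗ.[ℂ] H} {z : ℂ} {c : ℝ} (hc : 0 < c)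
    (hsurj : ∀ f : H, ∃ y, (y, f + z • y) ∈ T.graph)
    (hbound : ∀ y f : H, (y, f) ∈ T.graph → c * ‖y‖ ≤ ‖f - z • y‖) :
    ∃ R : H →L[ℂ] H, IsInverse T z R ∧ ∀ f, c * ‖R f‖ ≤ ‖f‖ := by
  choose r hr using hsurj
  have huniq : ∀ y f : H, (y, f + z • y) ∈ T.graph → r f = y := by
    intro y f h
    have h1 := T.graph.sub_mem (hr f) h
    have h2 := hbound _ _ h1
    simp only [smul_sub] at h2
    have : f + z • r f - (f + z • y) - (z • r f - z • y) = 0 := by abel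
    rw [this, norm_zero] at h2
    have h3 : ‖r f - y‖ ≤ 0 := by
      by_contra hlt
      push Not at hlt
      have := mul_pos hc hlt
      change c * ‖r f - y‖ ≤ 0 at h2
      linarith
    exact sub_eq_zero.1 (norm_le_zero_iff.1 h3)
  have hb : ∀ f, c * ‖r f‖ ≤ ‖f‖ := by
    intro f
    have := hbound _ _ (hr f)
    simpa using this
  let R0 : H →ₗ[ℂ] H :=
    { toFun := r
      map_add' := fun f g => huniq _ _ (by
        have := T.graph.add_mem (hr f) (hr g)
        convert! this using 1
        simp only [Prod.mk_add_mk, smul_add]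
        congr 1; abel)
      map_smul' := fun a f => huniq _ _ (by
        have := T.graph.smul_mem a (hr f)
        convert! this using 1
        simp only [Prod.smul_mk, smul_add, RingHom.id_apply]
        rw [smul_comm]) }
  let R : H →L[ℂ] H := R0.mkContinuous (1 / c) (fun f => by
    have := hb f
    change ‖r f‖ ≤ 1 / c * ‖f‖
    rw [one_div, inv_mul_eq_div, le_div_iff₀ hc]
    linarith)
  refine ⟨R, fun y f => ⟨fun h => huniq _ _ (by simpa using h), fun h => ?_⟩, hb⟩
  have h1 := hr (f - z • y)
  change r (f - z • y) = y at h
  rw [h] at h1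
  simpa using h1

/-- Symmetry of an unbounded operator, in terms of its graph. -/
def IsSymm (T : H →ₗ.[ℂ] H) : Prop :=
  ∀ y f w h : H, (y, f) ∈ T.graph → (w, h) ∈ T.graph → inner ℂ f w = inner ℂ y h

theorem IsSymm.bound {T : H →ₗ.[ℂ] H} (hT : IsSymm T) (z : ℂ) {y f : H}
    (h : (y, f) ∈ T.graph) : |z.im| * ‖y‖ ≤ ‖f - z • y‖ := by
  have h1 : (inner ℂ y f).im = 0 := by
    have e := hT _ _ _ _ h h
    rw [← inner_conj_symm] at e
    exact Complex.conj_eq_iff_im.1 e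
  have h2 : (inner ℂ y (f - z • y)).im = -(z.im * ‖y‖ ^ 2) := by
    rw [inner_sub_right, inner_smul_right, inner_self_eq_norm_sq_to_K, Complex.sub_im, h1,
      RCLike.ofReal_eq_complex_ofReal, ← Complex.ofReal_pow, Complex.im_mul_ofReal]
    ring
  have h3 : |z.im| * ‖y‖ ^ 2 ≤ ‖y‖ * ‖f - z • y‖ := by
    calc |z.im| * ‖y‖ ^ 2 = |(inner ℂ y (f - z • y)).im| := by
          rw [h2, abs_neg, abs_mul, abs_of_nonneg (sq_nonneg ‖y‖)]
      _ ≤ ‖inner ℂ y (f - z • y)‖ := Complex.abs_im_le_norm _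
      _ ≤ _ := norm_inner_le_norm _ _
  rcases (norm_nonneg y).eq_or_lt with h0 | h0
  · rw [← h0, mul_zero]; exact norm_nonneg _
  · nlinarith

variable [CompleteSpace H]

theorem exists_unit_one_add {W : H →L[ℂ] H} (hW : ‖W‖ < 1) :
    ∃ U : (H →L[ℂ] H)ˣ, (U : H →L[ℂ] H) = 1 + W := by
  have : ‖-W‖ < 1 := by rwa [norm_neg]
  exact ⟨Units.oneSub (-W) this, by simp⟩

/-- Perturbation of resolvents by an operator `V = T - T₀` for which `W = V (T₀ - z)⁻¹` has norm at
most `1 / 2`: then `(T - z)⁻¹ - (T₀ - z)⁻¹ = -(T₀ - z)⁻¹ W (1 + W)⁻¹`, so the difference is as small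
as `(T₀ - z)⁻¹ V (T₀ - z)⁻¹` is. -/
theorem exists_isInverse_of_perturbation {T₀ T : H →ₗ.[ℂ] H} {z : ℂ} {R₀ : H →L[ℂ] H}
    (hR : IsInverse T₀ z R₀) (hdom : T₀.domain = T.domain)
    (hV : ∀ y f₀ f : H, (y, f₀) ∈ T₀.graph → (y, f) ∈ T.graph →
      ‖f - f₀‖ ≤ 1 / 2 * ‖f₀ - z • y‖) :
    ∃ R : H →L[ℂ] H, IsInverse T z R ∧
      ∀ ε : ℝ, (∀ y f₀ f : H, (y, f₀) ∈ T₀.graph → (y, f) ∈ T.graph →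
        ‖R₀ (f - f₀)‖ ≤ ε * ‖f₀ - z • y‖) → ∀ x, ‖R x - R₀ x‖ ≤ 2 * ε * ‖x‖ := by
  have hmem : ∀ x, ∃ f, (R₀ x, f) ∈ T.graph := fun x => by
    rw [← LinearPMap.mem_domain_iff, ← hdom]
    exact LinearPMap.mem_domain_of_mem_graph (hR.mem_graph x)
  choose t hgr using hmem
  have huniq : ∀ x f, (R₀ x, f) ∈ T.graph → t x = f := fun x f h =>
    LinearPMap.mem_graph_snd_inj T (hgr x) h rfl
  let W₀ : H →ₗ[ℂ] H :=
    { toFun := fun x => t x - (x + z • R₀ x)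
      map_add' := fun x y => by
        have : t (x + y) = t x + t y := huniq _ _ (by
          rw [map_add]; exact T.graph.add_mem (hgr x) (hgr y))
        rw [this, map_add, smul_add]; abel
      map_smul' := fun a x => by
        have : t (a • x) = a • t x := huniq _ _ (by
          rw [map_smul]; exact T.graph.smul_mem a (hgr x))
        rw [this, map_smul, RingHom.id_apply, smul_sub, smul_add, smul_comm a z] }
  have hW₀ : ∀ x, ‖W₀ x‖ ≤ 1 / 2 * ‖x‖ := fun x => by
    have := hV _ _ _ (hR.mem_graph x) (hgr x)
    rwa [add_sub_cancel_right] at this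
  let W : H →L[ℂ] H := W₀.mkContinuous (1 / 2) hW₀
  have hWn : ‖W‖ < 1 := (W₀.mkContinuous_norm_le (by norm_num) hW₀).trans_lt (by norm_num)
  have hWeq : ∀ y f₀ f : H, (y, f₀) ∈ T₀.graph → (y, f) ∈ T.graph →
      W (f₀ - z • y) = f - f₀ := by
    intro y f₀ f h₀ h
    have e := (hR _ _).1 h₀
    have e3 := huniq (f₀ - z • y) f (by rwa [e])
    change t (f₀ - z • y) - (f₀ - z • y + z • R₀ (f₀ - z • y)) = _
    rw [e3, e]; abel
  obtain ⟨U, hU⟩ := exists_unit_one_add hWn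
  have hUi : ∀ x, U.1 (U⁻¹.1 x) = x := fun x => by
    rw [← mul_apply_eq_comp, U.mul_inv]; rfl
  have hUi' : ∀ x, U⁻¹.1 (U.1 x) = x := fun x => by
    rw [← mul_apply_eq_comp, U.inv_mul]; rfl
  have hUa : ∀ x, U.1 x = x + W x := fun x => by rw [hU]; rfl
  refine ⟨R₀ ∘L U⁻¹.1, fun y f => ⟨fun h => ?_, fun h => ?_⟩, fun ε hε x => ?_⟩
  · have hy : y ∈ T₀.domain := by
      rw [hdom]; exact LinearPMap.mem_domain_of_mem_graph h
    have h₀ := T₀.mem_graph ⟨y, hy⟩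
    have e := hWeq _ _ _ h₀ h
    have : f - z • y = U.1 (T₀ ⟨y, hy⟩ - z • y) := by
      rw [hUa, e]; abel
    rw [ContinuousLinearMap.comp_apply, this, hUi']
    exact (hR _ _).1 h₀
  · set x := U⁻¹.1 (f - z • y) with hx
    have hx' : R₀ x = y := h
    have h₀ := hR.mem_graph x
    have h1 := hgr x
    have e := hWeq _ _ _ h₀ h1
    rw [add_sub_cancel_right] at e
    have e2 : U.1 x = f - z • y := hUi _
    rw [hUa, e, hx'] at e2
    have e3 : t x = f := by
      have : t x - z • y = f - z • y := by rw [← e2]; abel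
      exact sub_left_injective this
    rw [e3, hx'] at h1
    exact h1
  · set u := U⁻¹.1 x with hu
    have hxu : x = u + W u := by rw [← hUa, hUi]
    have h1 : ‖W u‖ ≤ 1 / 2 * ‖u‖ := hW₀ u
    have h2 : ‖u‖ ≤ 2 * ‖x‖ := by
      have : ‖u‖ ≤ ‖x‖ + ‖W u‖ := by
        have : u = x - W u := by rw [hxu]; abel
        calc ‖u‖ = ‖x - W u‖ := by rw [← this]
          _ ≤ _ := norm_sub_le _ _
      linarith
    have h3 : R₀ (U⁻¹.1 x) - R₀ x = -R₀ (W u) := by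
      rw [← hu]; conv_lhs => rw [hxu]
      rw [map_add]; abel
    have h4 := hε _ _ _ (hR.mem_graph u) (hgr u)
    rw [← hWeq _ _ _ (hR.mem_graph u) (hgr u), add_sub_cancel_right] at h4
    change ‖R₀ (U⁻¹.1 x) - R₀ x‖ ≤ _
    rw [h3, norm_neg]
    rcases le_or_gt 0 ε with hε0 | hε0
    · nlinarith
    · have := norm_nonneg (R₀ (W u))
      have hu0 : ‖u‖ = 0 := by nlinarith [norm_nonneg u]
      have hx0 : x = 0 := by rw [hxu, norm_eq_zero.1 hu0]; simp
      rw [hu0] at h4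
      rw [hx0, norm_zero]; linarith

theorem exists_isInverse_of_near {T : H →ₗ.[ℂ] H} {z₀ z : ℂ} {R : H →L[ℂ] H}
    (hR : IsInverse T z₀ R) (hz : ‖(z - z₀) • R‖ < 1) (f : H) :
    ∃ y, (y, f + z • y) ∈ T.graph := by
  rw [← norm_neg] at hz
  obtain ⟨U, hU⟩ := exists_unit_one_add hz
  have hUi : U.1 (U⁻¹.1 (R f)) = R f := by
    rw [← mul_apply_eq_comp, U.mul_inv]; rfl
  refine ⟨U⁻¹.1 (R f), ?_⟩
  set y := U⁻¹.1 (R f)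
  rw [hU] at hUi
  have hUi : y - (z - z₀) • R y = R f := by
    rw [sub_eq_add_neg]; exact hUi
  rw [hR, add_sub_assoc, ← sub_smul, map_add, map_smul, ← hUi]
  abel

/-- A symmetric operator whose resolvent set contains all `z` far from the real axis is self-adjoint
and has all non-real numbers in its resolvent set. The passage from `re z ± iτ` with large `τ` to `z`
is a single Neumann series, as `‖(T - z)⁻¹‖ ≤ 1 / |im z|`. -/
theorem IsSymm.isSelfAdjoint {T : H →ₗ.[ℂ] H} (hT : IsSymm T) {τ₀ : ℝ} (hτ₀ : 0 < τ₀)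
    (hsurj : ∀ z : ℂ, τ₀ ≤ |z.im| → ∀ f : H, ∃ y, (y, f + z • y) ∈ T.graph) :
    IsSelfAdjoint T ∧ ∀ z : ℂ, z.im ≠ 0 →
      ∃ R : H →L[ℂ] H, IsInverse T z R ∧ ∀ f, |z.im| * ‖R f‖ ≤ ‖f‖ := by
  have hinv : ∀ z : ℂ, τ₀ ≤ |z.im| →
      ∃ R : H →L[ℂ] H, IsInverse T z R ∧ ∀ f, |z.im| * ‖R f‖ ≤ ‖f‖ := fun z hz =>
    exists_isInverse_of_bound (hτ₀.trans_le hz) (hsurj z hz) (fun y f h => hT.bound z h)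
  constructor
  · have hzim : τ₀ ≤ |(Complex.I * τ₀).im| := by simp [le_abs_self]
    have hzim' : τ₀ ≤ |(-(Complex.I * τ₀)).im| := by simp [le_abs_self]
    have hconj : (starRingEnd ℂ) (Complex.I * τ₀) = -(Complex.I * τ₀) := by simp
    have hperp : ∀ u : H, (∀ y f, (y, f) ∈ T.graph → inner ℂ u (f + (Complex.I * τ₀) • y) = 0) →
        u = 0 := by
      intro u hu
      obtain ⟨y, hy⟩ := hsurj _ hzim' u
      have := hu _ _ hy
      rw [neg_smul, neg_add_cancel_right] at this
      exact inner_self_eq_zero.1 this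
    have hdense : Dense (T.domain : Set H) := by
      rw [Submodule.dense_iff_topologicalClosure_eq_top,
        Submodule.topologicalClosure_eq_top_iff, Submodule.eq_bot_iff]
      intro u hu
      obtain ⟨w, hw⟩ := hsurj _ hzim u
      suffices hw0 : w = 0 by
        have h2 := T.graph_fst_eq_zero_snd hw hw0
        rw [hw0] at h2
        simpa using h2
      refine hperp w fun y f h => ?_
      have h1 := (Submodule.mem_orthogonal _ _).1 hu y (LinearPMap.mem_domain_of_mem_graph h)
      have h2 := hT _ _ _ _ h hw
      rw [← inner_conj_symm, map_eq_zero, inner_add_left, inner_smul_left, h2, inner_add_right,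
        h1, inner_smul_right, hconj]
      ring
    rw [LinearPMap.isSelfAdjoint_def]
    have hle : T ≤ T.adjoint := by
      refine LinearPMap.IsFormalAdjoint.le_adjoint hdense ?_
      intro x y
      exact hT _ _ _ _ (T.mem_graph x) (T.mem_graph y)
    refine le_antisymm ?_ hle
    refine LinearPMap.le_of_le_graph ?_
    rintro ⟨y, f⟩ hyf
    obtain ⟨w, hw⟩ := hsurj _ hzim (f - (Complex.I * τ₀) • y)
    obtain ⟨⟨y', hy'⟩, e1, e2⟩ := (LinearPMap.mem_graph_iff _).1 hyf
    simp only at e1 e2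
    subst e1
    have hyw : y' - w = 0 := by
      have hperp' : ∀ x g, (x, g) ∈ T.graph → inner ℂ (y' - w) (g + (Complex.I * τ₀) • x) = 0 := by
        intro x g hxg
        have hx := LinearPMap.mem_domain_of_mem_graph hxg
        have e3 : T ⟨x, hx⟩ = g := LinearPMap.mem_graph_snd_inj T (T.mem_graph ⟨x, hx⟩) hxg rfl
        have h1 := LinearPMap.adjoint_isFormalAdjoint hdense ⟨y', hy'⟩ ⟨x, hx⟩
        have h2 := hT _ _ _ _ hw hxg
        rw [e2] at h1
        simp only [e3] at h1
        rw [inner_sub_left, inner_add_right, inner_add_right, ← h1, ← h2, inner_add_left,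
          inner_sub_left, inner_smul_left, inner_smul_left, inner_smul_right, inner_smul_right,
          hconj]
        ring
      exact hperp _ hperp'
    have hyw' : y' = w := sub_eq_zero.1 hyw
    rw [← hyw'] at hw
    simpa using hw
  · intro z hz
    obtain ⟨z₀, h₀, h₁⟩ : ∃ z₀ : ℂ, τ₀ ≤ |z₀.im| ∧ ‖z - z₀‖ < |z₀.im| := by
      rcases lt_or_gt_of_ne hz with h | h
      · refine ⟨⟨z.re, -(τ₀ + |z.im|)⟩, ?_, ?_⟩
        · simp only [abs_neg]; rw [abs_of_pos (by positivity)]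
          linarith [abs_nonneg z.im]
        · have : z - ⟨z.re, -(τ₀ + |z.im|)⟩ = Complex.I * ((τ₀ : ℝ) : ℂ) := by
            rw [abs_of_neg h]
            apply Complex.ext <;> simp
          rw [this]
          simp only [abs_neg, norm_mul, Complex.norm_I, Complex.norm_real, Real.norm_eq_abs]
          rw [abs_of_pos hτ₀, abs_of_pos (by positivity)]
          linarith [abs_pos.2 hz]
      · refine ⟨⟨z.re, (τ₀ + |z.im|)⟩, ?_, ?_⟩
        · simp only; rw [abs_of_pos (by positivity)]
          linarith [abs_nonneg z.im]
        · have : z - ⟨z.re, (τ₀ + |z.im|)⟩ = -(Complex.I * ((τ₀ : ℝ) : ℂ)) := by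
            rw [abs_of_pos h]
            apply Complex.ext <;> simp
          rw [this]
          simp only [norm_neg, norm_mul, Complex.norm_I, Complex.norm_real, Real.norm_eq_abs]
          rw [abs_of_pos hτ₀, abs_of_pos (by positivity)]
          linarith [abs_pos.2 hz]
    obtain ⟨R, hR, hRb⟩ := hinv z₀ h₀
    have hpos := hτ₀.trans_le h₀
    refine exists_isInverse_of_bound (abs_pos.2 hz) (exists_isInverse_of_near hR ?_)
      (fun y f h => hT.bound z h)
    have hRn : ‖R‖ ≤ 1 / |z₀.im| := by
      refine R.opNorm_le_bound (by positivity) fun f => ?_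
      rw [one_div, inv_mul_eq_div, le_div_iff₀ hpos]
      linarith [hRb f]
    calc ‖(z - z₀) • R‖ = ‖z - z₀‖ * ‖R‖ := norm_smul _ _
      _ ≤ ‖z - z₀‖ * (1 / |z₀.im|) := by gcongr
      _ < 1 := by rw [mul_one_div, div_lt_one hpos]; exact h₁

end Abstract

/-! ### The symmetric Dirac operators and the free operator -/

theorem BC.conj_sign_mul_sign (bc : BC) : (starRingEnd ℂ) bc.sign * bc.sign = 1 := by
  cases bc <;> simp [BC.sign]

theorem BC.norm_sign (bc : BC) : ‖bc.sign‖ = 1 := by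
  cases bc <;> simp [BC.sign]

theorem Rep.graphRep {bc : BC} {v : Potential} {y f : L2} {u g : Fin 2 → ℝ → ℂ}
    (H : Rep bc y u g) (h : (y, f) ∈ (diracOp bc v).graph) : GraphRep bc v y f u g := by
  have hy : y ∈ (diracOp bc v).domain := LinearPMap.mem_domain_of_mem_graph h
  have e : diracOp bc v ⟨y, hy⟩ = f :=
    LinearPMap.mem_graph_snd_inj _ ((diracOp bc v).mem_graph ⟨y, hy⟩) h rfl
  have hd := H.diracOp_ae v hy
  rw [e] at hd
  exact ⟨H, hd.mono fun x hx => hx.1, hd.mono fun x hx => hx.2⟩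

/-- For `Q = conj P` the Dirac operator is symmetric: the boundary terms from integration by parts
cancel because the boundary sign has modulus one. -/
theorem isSymm_diracOp (bc : BC) {v : Potential}
    (hv : ∀ᵐ x ∂intervalMeasure, v.Q x = (starRingEnd ℂ) (v.P x)) : IsSymm (diracOp bc v) := by
  intro y f w h hyf hwh
  obtain ⟨u, g, H⟩ := mem_graph_iff.1 hyf
  obtain ⟨p, q, K⟩ := mem_graph_iff.1 hwh
  have hz (i : Fin 2) : ∫ x, ((starRingEnd ℂ) (g i x) * p i x + (starRingEnd ℂ) (u i x) * q i x)
      ∂intervalMeasure = 0 := by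
    rw [((H.prim i).conj.mul (K.prim i)).integral_eq, H.boundary i, K.boundary i, map_mul]
    linear_combination ((starRingEnd ℂ) (u i 0) * p i 0) * bc.conj_sign_mul_sign
  have hi (i : Fin 2) := ((H.prim i).conj.mul (K.prim i)).integrable
  rw [← sub_eq_zero, L2.inner_def, L2.inner_def, ← integral_sub (L2.integrable_inner _ _)
    (L2.integrable_inner _ _)]
  have key : ∫ x, (-Complex.I * ((starRingEnd ℂ) (g 0 x) * p 0 x + (starRingEnd ℂ) (u 0 x) * q 0 x)
      + Complex.I * ((starRingEnd ℂ) (g 1 x) * p 1 x + (starRingEnd ℂ) (u 1 x) * q 1 x))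
      ∂intervalMeasure = 0 := by
    rw [integral_add ((hi 0).const_mul _) ((hi 1).const_mul _), integral_const_mul,
      integral_const_mul, hz, hz]
    simp
  rw [← key]
  refine integral_congr_ae ?_
  filter_upwards [H.fst, H.snd, K.fst, K.snd, ae_all_iff.2 H.ae_eq, ae_all_iff.2 K.ae_eq, hv]
    with x h1 h2 h3 h4 h5 h6 h7
  simp only [PiLp.inner_apply, Fin.sum_univ_two, RCLike.inner_apply, h1, h2, h3, h4, h5, h6, h7,
    map_add, map_mul, map_neg, Complex.conj_I, Complex.conj_conj]
  ring

/-- The Dirac operator with zero potential. -/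
noncomputable abbrev freeOp (bc : BC) : L2 →ₗ.[ℂ] L2 := diracOp bc ⟨0, 0⟩

theorem coeFn_zero_Lp : ∀ᵐ x ∂intervalMeasure, (0 : Lp ℂ 2 intervalMeasure) x = 0 :=
  Lp.coeFn_zero ..

theorem isSymm_freeOp (bc : BC) : IsSymm (freeOp bc) := by
  refine isSymm_diracOp bc ?_
  filter_upwards [coeFn_zero_Lp] with x hx
  rw [hx, map_zero]

theorem GraphRep.free {bc : BC} {y f : L2} {u g : Fin 2 → ℝ → ℂ}
    (H : GraphRep bc ⟨0, 0⟩ y f u g) : ∀ᵐ x ∂intervalMeasure,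
      g 0 x = -Complex.I * f x 0 ∧ g 1 x = Complex.I * f x 1 := by
  filter_upwards [H.fst, H.snd, coeFn_zero_Lp] with x h1 h2 h0
  rw [h1, h2, h0]
  constructor
  · linear_combination (g 0 x) * Complex.I_mul_I
  · linear_combination (g 1 x) * Complex.I_mul_I

/-- Two scalar boundary value problems `i u₀' = z u₀ + f₀` and `-i u₁' = z u₁ + f₁` make up the
equation `(L⁰ - z) y = f`. -/
theorem mem_freeOp_graph {bc : BC} {z : ℂ} {f : L2} {a b : ℝ → ℂ}
    (ha : HasPrim a (fun x => -Complex.I * (z * a x + f x 0)))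
    (hb : HasPrim b (fun x => -Complex.I * (-z * b x + -f x 1)))
    (ha' : a Real.pi = bc.sign * a 0) (hb' : b Real.pi = bc.sign * b 0) :
    ∃ y : L2, (y, f + z • y) ∈ (freeOp bc).graph ∧
      ∀ᵐ x ∂intervalMeasure, y x 0 = a x ∧ y x 1 = b x := by
  have hu : ∀ i, MemLp ((![a, b] : Fin 2 → ℝ → ℂ) i) 2 intervalMeasure := by
    intro i; fin_cases i
    · exact ha.memLp_two
    · exact hb.memLp_two
  refine ⟨ofCoord ![a, b] hu, mem_graph_iff.2 ⟨![a, b],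
    ![fun x => -Complex.I * (z * a x + f x 0), fun x => -Complex.I * (-z * b x + -f x 1)],
    ⟨fun i => ?_, fun i => ?_, fun i => ?_, fun i => ?_⟩, ?_, ?_⟩, ?_⟩
  · fin_cases i
    · exact ha
    · exact hb
  · fin_cases i
    · exact ((ha.memLp_two.const_mul z).add (memLp_coord f 0)).const_mul _
    · exact ((hb.memLp_two.const_mul (-z)).add (memLp_coord f 1).neg).const_mul _
  · fin_cases i
    · exact ha'
    · exact hb'
  · exact (ofCoord_ae _ hu).mono fun x hx => hx i
  · filter_upwards [ofCoord_ae _ hu, coord_add f (z • ofCoord ![a, b] hu),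
      coord_smul z (ofCoord ![a, b] hu), coeFn_zero_Lp] with x h1 h2 h3 h4
    rw [h2, h3, h1, h4]
    simp only [Matrix.cons_val_zero, Matrix.cons_val_one]
    linear_combination (z * a x + f x 0) * Complex.I_mul_I
  · filter_upwards [ofCoord_ae _ hu, coord_add f (z • ofCoord ![a, b] hu),
      coord_smul z (ofCoord ![a, b] hu), coeFn_zero_Lp] with x h1 h2 h3 h4
    rw [h2, h3, h1, h4]
    simp only [Matrix.cons_val_zero, Matrix.cons_val_one]
    linear_combination (z * b x + f x 1) * Complex.I_mul_I
  · filter_upwards [ofCoord_ae _ hu] with x h1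
    exact ⟨h1 0, h1 1⟩

theorem exists_boundary_solution (bc : BC) {z : ℂ} (hz : z.im ≠ 0) {f : ℝ → ℂ}
    (hf : Integrable f intervalMeasure) :
    ∃ u : ℝ → ℂ, HasPrim u (fun x => -Complex.I * (z * u x + f x)) ∧
      u Real.pi = bc.sign * u 0 := by
  set E := Complex.exp (-Complex.I * z * Real.pi) with hE
  set J := ∫ x, Complex.exp (Complex.I * z * x) * f x ∂intervalMeasure
  have hne : E - bc.sign ≠ 0 := by
    intro h
    have h1 := congrArg norm (sub_eq_zero.1 h)
    rw [bc.norm_sign, hE, Complex.norm_exp, Real.exp_eq_one_iff] at h1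
    simp [Real.pi_ne_zero, hz] at h1
  obtain ⟨u, h1, h2, h3⟩ := HasPrim.exists_solution z (Complex.I * J * E / (E - bc.sign)) hf
  refine ⟨u, h1, ?_⟩
  rw [h3, h2, ← hE]
  change E * (Complex.I * J * E / (E - bc.sign) - Complex.I * J) = _
  field_simp
  ring

theorem freeOp_surjective (bc : BC) {z : ℂ} (hz : z.im ≠ 0) (f : L2) :
    ∃ y, (y, f + z • y) ∈ (freeOp bc).graph := by
  have hint (i : Fin 2) : Integrable (fun x => f x i) intervalMeasure :=
    (memLp_coord f i).integrable (by norm_num)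
  obtain ⟨a, ha, ha'⟩ := exists_boundary_solution bc hz (hint 0)
  obtain ⟨b, hb, hb'⟩ := exists_boundary_solution bc (z := -z) (by simpa using hz) (hint 1).neg
  obtain ⟨y, hy, -⟩ := mem_freeOp_graph ha hb ha' hb'
  exact ⟨y, hy⟩

theorem freeOp_isSelfAdjoint (bc : BC) : IsSelfAdjoint (freeOp bc) ∧ ∀ z : ℂ, z.im ≠ 0 →
    ∃ R : L2 →L[ℂ] L2, IsInverse (freeOp bc) z R ∧ ∀ f, |z.im| * ‖R f‖ ≤ ‖f‖ :=
  (isSymm_freeOp bc).isSelfAdjoint one_pos fun _ hz =>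
    freeOp_surjective bc (abs_pos.1 (one_pos.trans_le hz))

/-! ### Relative bounds for the potential -/

theorem norm_sq_Lp {E : Type*} [NormedAddCommGroup E] [InnerProductSpace ℂ E]
    (f : Lp E 2 intervalMeasure) : ‖f‖ ^ 2 = ∫ x, ‖f x‖ ^ 2 ∂intervalMeasure := by
  have h : (inner ℂ f f : ℂ) = ((‖f‖ ^ 2 : ℝ) : ℂ) := by
    rw [inner_self_eq_norm_sq_to_K]; norm_cast
  rw [L2.inner_def] at h
  have h2 : ∫ x, (inner ℂ (f x) (f x) : ℂ) ∂intervalMeasure =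
      ∫ x, ((‖f x‖ ^ 2 : ℝ) : ℂ) ∂intervalMeasure := by
    refine integral_congr_ae (Filter.Eventually.of_forall fun x => ?_)
    simp only [inner_self_eq_norm_sq_to_K]
    norm_cast
  rw [h2, integral_complex_ofReal] at h
  exact_mod_cast h.symm

theorem integrable_norm_sq {E : Type*} [NormedAddCommGroup E] {f : ℝ → E}
    (h : MemLp f 2 intervalMeasure) : Integrable (fun x => ‖f x‖ ^ 2) intervalMeasure :=
  h.norm.integrable_sq

theorem norm_sq_L2 (y : L2) :
    ‖y‖ ^ 2 = ∫ x, (‖y x 0‖ ^ 2 + ‖y x 1‖ ^ 2) ∂intervalMeasure := by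
  rw [norm_sq_Lp]
  refine integral_congr_ae (Filter.Eventually.of_forall fun x => ?_)
  simp only [EuclideanSpace.norm_sq_eq, Fin.sum_univ_two]

theorem integral_coord_sq_le (y : L2) (i : Fin 2) :
    ∫ x, ‖y x i‖ ^ 2 ∂intervalMeasure ≤ ‖y‖ ^ 2 := by
  rw [norm_sq_Lp]
  refine integral_mono (integrable_norm_sq (memLp_coord y i))
    (integrable_norm_sq (Lp.memLp y)) fun x => ?_
  simp only
  gcongr
  exact PiLp.norm_apply_le (y x) i

theorem measureReal_univ : intervalMeasure.real univ = Real.pi := by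
  simp [intervalMeasure, Measure.real, Real.pi_pos.le]

namespace HasPrim

variable {u g : ℝ → ℂ}

theorem norm_sub_le (H : HasPrim u g) {x s : ℝ} (hx : x ∈ Icc 0 Real.pi)
    (hs : s ∈ Icc 0 Real.pi) : ‖u x - u s‖ ≤ ∫ r, ‖g r‖ ∂intervalMeasure := by
  have h0 : (0 : ℝ) ∈ Icc 0 Real.pi := left_mem_Icc.2 Real.pi_pos.le
  have e : u x - u s = ∫ r in s..x, g r := by
    rw [H.eq x hx, H.eq s hs, add_sub_add_left_eq_sub,
      intervalIntegral.integral_interval_sub_left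
        (intervalIntegrable_of_integrable' H.integrable h0 hx)
        (intervalIntegrable_of_integrable' H.integrable h0 hs)]
  rw [e]
  refine intervalIntegral.norm_integral_le_integral_norm_uIoc.trans ?_
  refine setIntegral_mono_set H.integrable.norm
    (Filter.Eventually.of_forall fun _ => norm_nonneg _) ?_
  exact (uIoc_subset_uIcc.trans (uIcc_subset_Icc hs hx)).eventuallyLE

theorem norm_le (H : HasPrim u g) {x : ℝ} (hx : x ∈ Icc 0 Real.pi) :
    Real.pi * ‖u x‖ ≤ ∫ r, ‖u r‖ ∂intervalMeasure + Real.pi * ∫ r, ‖g r‖ ∂intervalMeasure := by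
  have hu := (ContinuousOn.integrable_intervalMeasure H.continuousOn).norm
  have h : ∫ _, ‖u x‖ ∂intervalMeasure ≤
      ∫ r, (‖u r‖ + ∫ q, ‖g q‖ ∂intervalMeasure) ∂intervalMeasure := by
    refine integral_mono_ae (integrable_const _) (hu.add (integrable_const _)) ?_
    filter_upwards [ae_mem_Icc] with s hs
    have h1 := H.norm_sub_le hx hs
    have h2 : ‖u x‖ ≤ ‖u s‖ + ‖u x - u s‖ := by
      simpa using norm_add_le (u s) (u x - u s)
    linarith
  rw [integral_add hu (integrable_const _)] at h
  simpa only [integral_const, measureReal_univ, smul_eq_mul] using h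

end HasPrim

theorem norm_conj_mul_add_le (a F z : ℂ) {s : ℂ} (hs : s = Complex.I ∨ s = -Complex.I)
    (hz : z.im ≠ 0) :
    ‖(starRingEnd ℂ) (s * (F + z * a)) * a + (starRingEnd ℂ) a * (s * (F + z * a))‖ ≤
      3 * |z.im| * ‖a‖ ^ 2 + ‖F‖ ^ 2 / |z.im| := by
  have hzc : z - (starRingEnd ℂ) z = 2 * z.im * Complex.I := by
    rw [Complex.sub_conj]; push_cast; ring
  have e : (starRingEnd ℂ) (s * (F + z * a)) * a + (starRingEnd ℂ) a * (s * (F + z * a)) =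
      s * ((starRingEnd ℂ) a * F - (starRingEnd ℂ) F * a +
        (2 * z.im * Complex.I) * ((starRingEnd ℂ) a * a)) := by
    rw [← hzc]
    rcases hs with rfl | rfl <;> simp only [map_mul, map_add, map_neg, Complex.conj_I] <;> ring
  have hs1 : ‖s‖ = 1 := by rcases hs with rfl | rfl <;> simp
  rw [e, norm_mul, hs1, one_mul]
  have hpos : 0 < |z.im| := abs_pos.2 hz
  have h1 : ‖(starRingEnd ℂ) a * F - (starRingEnd ℂ) F * a‖ ≤ 2 * (‖a‖ * ‖F‖) := by
    refine (norm_sub_le _ _).trans (le_of_eq ?_)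
    simp only [norm_mul, RCLike.norm_conj]; ring
  have h2 : ‖(2 * z.im * Complex.I) * ((starRingEnd ℂ) a * a)‖ = 2 * |z.im| * ‖a‖ ^ 2 := by
    simp only [norm_mul, RCLike.norm_conj, Complex.norm_I, Complex.norm_real, Real.norm_eq_abs,
      Complex.norm_ofNat]
    ring
  have h3 : 2 * (‖a‖ * ‖F‖) ≤ |z.im| * ‖a‖ ^ 2 + ‖F‖ ^ 2 / |z.im| := by
    rw [← sub_nonneg]
    have : |z.im| * ‖a‖ ^ 2 + ‖F‖ ^ 2 / |z.im| - 2 * (‖a‖ * ‖F‖) =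
        (|z.im| * ‖a‖ - ‖F‖) ^ 2 / |z.im| := by
      field_simp; ring
    rw [this]; positivity
  refine (norm_add_le _ _).trans ?_
  rw [h2]; linarith

/-- The free resolvent maps `L²` to `L^∞` with norm of order `|im z|^(-1/2)`, uniformly in `re z`:
the derivative of `|u|²` only involves the imaginary part of `z`. -/
theorem free_norm_sq_le {bc : BC} {y f : L2} {u g : Fin 2 → ℝ → ℂ}
    (H : GraphRep bc ⟨0, 0⟩ y f u g) {z : ℂ} (hz : 1 ≤ |z.im|) (i : Fin 2) {x : ℝ}
    (hx : x ∈ Icc 0 Real.pi) : ‖u i x‖ ^ 2 ≤ 5 / |z.im| * ‖f - z • y‖ ^ 2 := by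
  have hpos : 0 < |z.im| := one_pos.trans_le hz
  set F := f - z • y with hF
  have hd := (H.prim i).conj.mul (H.prim i)
  have hb := (isSymm_freeOp bc).bound z (mem_graph_iff.2 ⟨u, g, H⟩)
  rw [← hF] at hb
  have hy2 : |z.im| * ‖y‖ ^ 2 ≤ ‖F‖ ^ 2 / |z.im| := by
    rw [le_div_iff₀ hpos]
    nlinarith [norm_nonneg y, norm_nonneg F, mul_nonneg hpos.le (norm_nonneg y)]
  have hu2 : ∫ r, ‖u i r‖ ^ 2 ∂intervalMeasure ≤ ‖y‖ ^ 2 := by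
    refine le_trans (le_of_eq ?_) (integral_coord_sq_le y i)
    refine integral_congr_ae ?_
    filter_upwards [H.ae_eq i] with r hr
    rw [hr]
  have hint : ∫ r, ‖(starRingEnd ℂ) (g i r) * u i r + (starRingEnd ℂ) (u i r) * g i r‖
      ∂intervalMeasure ≤ 4 * (‖F‖ ^ 2 / |z.im|) := by
    have h1 : ∫ r, ‖(starRingEnd ℂ) (g i r) * u i r + (starRingEnd ℂ) (u i r) * g i r‖
      ∂intervalMeasure ≤ ∫ r, (3 * |z.im| * ‖u i r‖ ^ 2 + ‖F r i‖ ^ 2 / |z.im|)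
        ∂intervalMeasure := by
      refine integral_mono_ae hd.integrable.norm
        (((integrable_norm_sq (H.prim i).memLp_two).const_mul _).add
          ((integrable_norm_sq (memLp_coord F i)).div_const _)) ?_
      filter_upwards [H.free, H.ae_eq i, coord_sub f (z • y), coord_smul z y]
        with r h1 h2 h3 h4
      have hf : f r i = F r i + z * u i r := by
        rw [hF, h3, h4, h2]; ring
      fin_cases i
      · have := norm_conj_mul_add_le (u 0 r) (F r 0) z (Or.inr rfl) (abs_pos.1 hpos)
        simp only [Fin.zero_eta] at hf ⊢
        rwa [h1.1, hf]
      · have := norm_conj_mul_add_le (u 1 r) (F r 1) z (Or.inl rfl) (abs_pos.1 hpos)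
        simp only [Fin.mk_one] at hf ⊢
        rwa [h1.2, hf]
    rw [integral_add ((integrable_norm_sq (H.prim i).memLp_two).const_mul _)
          ((integrable_norm_sq (memLp_coord F i)).div_const _), integral_const_mul,
          integral_div] at h1
    have h2 : (∫ r, ‖F r i‖ ^ 2 ∂intervalMeasure) / |z.im| ≤ ‖F‖ ^ 2 / |z.im| := by
      gcongr; exact integral_coord_sq_le F i
    nlinarith [mul_le_mul_of_nonneg_left hu2 hpos.le]
  have hsup := hd.norm_le hx
  have hn : ∀ r, ‖(starRingEnd ℂ) (u i r) * u i r‖ = ‖u i r‖ ^ 2 := fun r => by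
    rw [norm_mul, RCLike.norm_conj, sq]
  simp only [hn] at hsup
  have h5 : ‖y‖ ^ 2 ≤ ‖F‖ ^ 2 / |z.im| := by nlinarith [sq_nonneg ‖y‖]
  have h6 : 0 ≤ ‖F‖ ^ 2 / |z.im| := by positivity
  have h7 : Real.pi * ‖u i x‖ ^ 2 ≤ Real.pi * (5 * (‖F‖ ^ 2 / |z.im|)) := by
    nlinarith [Real.pi_gt_three, mul_le_mul_of_nonneg_left hint Real.pi_pos.le]
  have h8 := le_of_mul_le_mul_left h7 Real.pi_pos
  calc _ ≤ _ := h8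
    _ = _ := by ring

/-- The squared `L²` distance of two potentials. -/
noncomputable def Potential.distSq (v w : Potential) : ℝ := ‖v.P - w.P‖ ^ 2 + ‖v.Q - w.Q‖ ^ 2

theorem Rep.norm_sq_sub_le {bc : BC} {v w : Potential} {y f h : L2} {u g : Fin 2 → ℝ → ℂ}
    (H : Rep bc y u g) (hf : (y, f) ∈ (diracOp bc v).graph) (hh : (y, h) ∈ (diracOp bc w).graph)
    {C : ℝ} (hC : ∀ i, ∀ x ∈ Icc 0 Real.pi, ‖u i x‖ ^ 2 ≤ C) :
    ‖f - h‖ ^ 2 ≤ C * v.distSq w := by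
  have Hf := H.graphRep hf
  have Hh := H.graphRep hh
  have hP := integrable_norm_sq (Lp.memLp (v.P - w.P))
  have hQ := integrable_norm_sq (Lp.memLp (v.Q - w.Q))
  rw [norm_sq_L2, Potential.distSq, norm_sq_Lp, norm_sq_Lp, ← integral_add hP hQ,
    ← integral_const_mul]
  refine integral_mono_ae ((integrable_norm_sq (memLp_coord _ 0)).add
    (integrable_norm_sq (memLp_coord _ 1))) ((hP.add hQ).const_mul _) ?_
  filter_upwards [Hf.fst, Hf.snd, Hh.fst, Hh.snd, coord_sub f h, Lp.coeFn_sub v.P w.P,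
    Lp.coeFn_sub v.Q w.Q, ae_mem_Icc] with x h1 h2 h3 h4 h5 h6 h7 hx
  have e0 : (f - h) x 0 = (v.P - w.P) x * u 1 x := by
    rw [h5, h1, h3, h6, Pi.sub_apply]; ring
  have e1 : (f - h) x 1 = (v.Q - w.Q) x * u 0 x := by
    rw [h5, h2, h4, h7, Pi.sub_apply]; ring
  simp only [e0, e1, norm_mul, mul_pow]
  nlinarith [mul_le_mul_of_nonneg_left (hC 1 x hx) (sq_nonneg ‖(v.P - w.P) x‖),
    mul_le_mul_of_nonneg_left (hC 0 x hx) (sq_nonneg ‖(v.Q - w.Q) x‖)]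

theorem Potential.distSq_nonneg (v w : Potential) : 0 ≤ v.distSq w := by
  unfold Potential.distSq; positivity

/-- The relative bound `‖(V - W)(L⁰ - z)⁻¹‖ ≤ (5 / |im z|)^(1/2) ‖v - w‖`. -/
theorem norm_sq_sub_le_resolvent {bc : BC} {v w : Potential} {y f₀ f h : L2} {z : ℂ}
    (hz : 1 ≤ |z.im|) (h₀ : (y, f₀) ∈ (freeOp bc).graph) (hf : (y, f) ∈ (diracOp bc v).graph)
    (hh : (y, h) ∈ (diracOp bc w).graph) :
    ‖f - h‖ ^ 2 ≤ 5 / |z.im| * v.distSq w * ‖f₀ - z • y‖ ^ 2 := by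
  obtain ⟨u, g, H⟩ := mem_graph_iff.1 h₀
  have := H.norm_sq_sub_le hf hh (fun i x hx => free_norm_sq_le H hz i hx)
  linarith

theorem norm_sub_le_half {bc : BC} {v : Potential} {y f₀ f : L2} {z : ℂ}
    (hz : 1 ≤ |z.im|) (hz' : 20 * v.distSq ⟨0, 0⟩ ≤ |z.im|) (h₀ : (y, f₀) ∈ (freeOp bc).graph)
    (hf : (y, f) ∈ (diracOp bc v).graph) : ‖f - f₀‖ ≤ 1 / 2 * ‖f₀ - z • y‖ := by
  have h := norm_sq_sub_le_resolvent hz h₀ hf h₀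
  have hpos : 0 < |z.im| := one_pos.trans_le hz
  have h2 : 5 / |z.im| * v.distSq ⟨0, 0⟩ ≤ 1 / 4 := by
    rw [div_mul_eq_mul_div, div_le_iff₀ hpos]; linarith
  refine abs_le_of_sq_le_sq' ?_ (by positivity) |>.2
  nlinarith [sq_nonneg ‖f₀ - z • y‖]

theorem exists_isInverse_diracOp (bc : BC) (v : Potential) {z : ℂ}
    (hz : 1 ≤ |z.im|) (hz' : 20 * v.distSq ⟨0, 0⟩ ≤ |z.im|) :
    ∃ R, IsInverse (diracOp bc v) z R := by
  obtain ⟨R₀, hR₀, -⟩ := (freeOp_isSelfAdjoint bc).2 z (abs_pos.1 (one_pos.trans_le hz))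
  obtain ⟨R, hR, -⟩ := exists_isInverse_of_perturbation (T := diracOp bc v) hR₀ rfl
    (fun y f₀ f h₀ hf => norm_sub_le_half hz hz' h₀ hf)
  exact ⟨R, hR⟩

/-- The Dirac operator with `Q = conj P` is self-adjoint. -/
theorem diracOp_isSelfAdjoint (bc : BC) {v : Potential}
    (hv : ∀ᵐ x ∂intervalMeasure, v.Q x = (starRingEnd ℂ) (v.P x)) :
    IsSelfAdjoint (diracOp bc v) ∧ ∀ z : ℂ, z.im ≠ 0 →
      ∃ R, IsInverse (diracOp bc v) z R ∧ ∀ f, |z.im| * ‖R f‖ ≤ ‖f‖ := by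
  refine (isSymm_diracOp bc hv).isSelfAdjoint
    (τ₀ := max 1 (20 * v.distSq ⟨0, 0⟩)) (by positivity) fun z hz f => ?_
  obtain ⟨R, hR⟩ := exists_isInverse_diracOp bc v (le_of_max_le_left hz) (le_of_max_le_right hz)
  exact ⟨R f, hR.mem_graph f⟩

/-! ### Similarity to a self-adjoint operator for `t > 0` -/

/-- The constant diagonal matrix `diag(a, b)` acting on `L²([0, π], ℂ²)`. -/
noncomputable def diagMap (a b : ℂ) : L2 →L[ℂ] L2 :=
  (LinearMap.toContinuousLinearMap
    ({ toFun := fun c => !₂[a * c 0, b * c 1]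
       map_add' := fun c d => by ext i; fin_cases i <;> simp [mul_add]
       map_smul' := fun r c => by ext i; fin_cases i <;> simp [mul_left_comm] } :
      C2 →ₗ[ℂ] C2)).compLpL 2 intervalMeasure

theorem diagMap_ae (a b : ℂ) (y : L2) : ∀ᵐ x ∂intervalMeasure,
    diagMap a b y x 0 = a * y x 0 ∧ diagMap a b y x 1 = b * y x 1 := by
  filter_upwards [ContinuousLinearMap.coeFn_compLpL (p := 2) (μ := intervalMeasure)
    (LinearMap.toContinuousLinearMap
    ({ toFun := fun c => !₂[a * c 0, b * c 1]
       map_add' := fun c d => by ext i; fin_cases i <;> simp [mul_add]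
       map_smul' := fun r c => by ext i; fin_cases i <;> simp [mul_left_comm] } :
      C2 →ₗ[ℂ] C2)) y] with x hx
  rw [diagMap, hx]
  simp

theorem diagMap_diagMap {a b c d : ℂ} (hac : a * c = 1) (hbd : b * d = 1) (y : L2) :
    diagMap a b (diagMap c d y) = y := by
  refine ext_coord fun i => ?_
  fin_cases i
  · filter_upwards [diagMap_ae a b (diagMap c d y), diagMap_ae c d y] with x h1 h2
    simp only [Fin.zero_eta]
    rw [h1.1, h2.1, ← mul_assoc, hac, one_mul]
  · filter_upwards [diagMap_ae a b (diagMap c d y), diagMap_ae c d y] with x h1 h2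
    simp only [Fin.mk_one]
    rw [h1.2, h2.2, ← mul_assoc, hbd, one_mul]

/-- `diag(a, b)` as a bounded, boundedly invertible operator. -/
noncomputable def diagEquiv {a b : ℂ} (ha : a ≠ 0) (hb : b ≠ 0) : L2 ≃L[ℂ] L2 :=
  ContinuousLinearEquiv.equivOfInverse (diagMap a b) (diagMap a⁻¹ b⁻¹)
    (fun y => diagMap_diagMap (inv_mul_cancel₀ ha) (inv_mul_cancel₀ hb) y)
    (fun y => diagMap_diagMap (mul_inv_cancel₀ ha) (mul_inv_cancel₀ hb) y)

theorem diagMap_mem_graph {bc : BC} {v w : Potential} {a b : ℂ}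
    (hP : ∀ᵐ x ∂intervalMeasure, w.P x * b = a * v.P x)
    (hQ : ∀ᵐ x ∂intervalMeasure, w.Q x * a = b * v.Q x) {y f : L2}
    (h : (y, f) ∈ (diracOp bc v).graph) :
    (diagMap a b y, diagMap a b f) ∈ (diracOp bc w).graph := by
  obtain ⟨u, g, H⟩ := mem_graph_iff.1 h
  refine mem_graph_iff.2 ⟨![fun x => a * u 0 x, fun x => b * u 1 x],
    ![fun x => a * g 0 x, fun x => b * g 1 x],
    ⟨fun i => ?_, fun i => ?_, fun i => ?_, fun i => ?_⟩, ?_, ?_⟩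
  · fin_cases i
    · exact (H.prim 0).const_mul a
    · exact (H.prim 1).const_mul b
  · fin_cases i
    · exact (H.memLp 0).const_mul a
    · exact (H.memLp 1).const_mul b
  · fin_cases i
    · simp [H.boundary, mul_left_comm]
    · simp [H.boundary, mul_left_comm]
  · fin_cases i
    · filter_upwards [diagMap_ae a b y, H.ae_eq 0] with x h1 h2
      simp [h1.1, h2]
    · filter_upwards [diagMap_ae a b y, H.ae_eq 1] with x h1 h2
      simp [h1.2, h2]
  · filter_upwards [diagMap_ae a b f, H.fst, hP] with x h1 h2 h3
    rw [h1.1, h2]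
    simp only [Matrix.cons_val_zero, Matrix.cons_val_one]
    linear_combination (-u 1 x) * h3
  · filter_upwards [diagMap_ae a b f, H.snd, hQ] with x h1 h2 h3
    rw [h1.2, h2]
    simp only [Matrix.cons_val_zero, Matrix.cons_val_one]
    linear_combination (-u 0 x) * h3

theorem diagEquiv_graph_iff {bc : BC} {v w : Potential} {a b : ℂ} (ha : a ≠ 0) (hb : b ≠ 0)
    (hP : ∀ᵐ x ∂intervalMeasure, w.P x * b = a * v.P x)
    (hQ : ∀ᵐ x ∂intervalMeasure, w.Q x * a = b * v.Q x) (y f : L2) :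
    (y, f) ∈ (diracOp bc v).graph ↔
      (diagEquiv ha hb y, diagEquiv ha hb f) ∈ (diracOp bc w).graph := by
  refine ⟨diagMap_mem_graph hP hQ, fun h => ?_⟩
  have h1 := diagMap_mem_graph (w := v) (a := a⁻¹) (b := b⁻¹) ?_ ?_ h
  · have e (k : L2) : diagMap a⁻¹ b⁻¹ (diagEquiv ha hb k) = k :=
      diagMap_diagMap (inv_mul_cancel₀ ha) (inv_mul_cancel₀ hb) k
    rwa [e, e] at h1
  · filter_upwards [hP] with x hx
    field_simp
    linear_combination -hx
  · filter_upwards [hQ] with x hx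
    field_simp
    linear_combination -hx

/-- Conjugation by `diag(√t, 1)` turns the potential `(P, t conj P)` into `(√t P, √t conj P)`. -/
theorem similar_selfAdjoint {t : ℝ} (ht : 0 < t) {v : Potential} (hv : v ∈ classX t) (bc : BC) :
    (∃ T : L2 →ₗ.[ℂ] L2, IsSelfAdjoint T ∧ Similar (diracOp bc v) T) ∧
      ∀ z ∈ spectrum (diracOp bc v), z.im = 0 := by
  have hs : (Real.sqrt t : ℂ) ≠ 0 := by
    exact_mod_cast (Real.sqrt_pos.2 ht).ne'
  have hst : (t : ℂ) = Real.sqrt t * Real.sqrt t := by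
    rw [← Complex.ofReal_mul, Real.mul_self_sqrt ht.le]
  let w : Potential := ⟨(Real.sqrt t : ℂ) • v.P, (Real.sqrt t : ℂ)⁻¹ • v.Q⟩
  have hwP : ∀ᵐ x ∂intervalMeasure, w.P x = Real.sqrt t * v.P x := Lp.coeFn_smul _ _
  have hwQ : ∀ᵐ x ∂intervalMeasure, w.Q x = (Real.sqrt t : ℂ)⁻¹ * v.Q x := Lp.coeFn_smul _ _
  have hw : ∀ᵐ x ∂intervalMeasure, w.Q x = (starRingEnd ℂ) (w.P x) := by
    filter_upwards [hwP, hwQ, hv] with x h1 h2 h3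
    rw [h1, h2, h3, map_mul, Complex.conj_ofReal, hst]
    field_simp
  have hA := diagEquiv_graph_iff (bc := bc) (v := v) (w := w) hs one_ne_zero
    (by filter_upwards [hwP] with x hx; rw [hx, mul_one])
    (by filter_upwards [hwQ] with x hx; rw [hx]; field_simp)
  obtain ⟨h1, h2⟩ := diracOp_isSelfAdjoint bc hw
  refine ⟨⟨_, h1, _, hA⟩, fun z hz => ?_⟩
  by_contra hne
  obtain ⟨R, hR, -⟩ := h2 z hne
  exact hz (hR.of_similar _ hA).mem_resolventSet

/-! ### The antilinear symmetry for `t < 0` -/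

theorem memLp_conj {u : ℝ → ℂ} (h : MemLp u 2 intervalMeasure) :
    MemLp (fun x => (starRingEnd ℂ) (u x)) 2 intervalMeasure :=
  (Complex.conjCLE : ℂ →L[ℝ] ℂ).comp_memLp' h

theorem memLp_conjMap (t : ℝ) (y : L2) : ∀ i, MemLp ((![fun x => (starRingEnd ℂ) (y x 1),
    fun x => t * (starRingEnd ℂ) (y x 0)] : Fin 2 → ℝ → ℂ) i) 2 intervalMeasure := by
  intro i
  fin_cases i
  · exact memLp_conj (memLp_coord y 1)
  · exact (memLp_conj (memLp_coord y 0)).const_mul _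

/-- The antilinear map `(y₀, y₁) ↦ (conj y₁, t conj y₀)`. Its square is multiplication by `t`, and
it commutes with the Dirac operators of class `X_t`. -/
noncomputable def conjMap (t : ℝ) (y : L2) : L2 := ofCoord _ (memLp_conjMap t y)

theorem conjMap_ae (t : ℝ) (y : L2) : ∀ᵐ x ∂intervalMeasure,
    conjMap t y x 0 = (starRingEnd ℂ) (y x 1) ∧
    conjMap t y x 1 = t * (starRingEnd ℂ) (y x 0) := by
  filter_upwards [ofCoord_ae _ (memLp_conjMap t y)] with x hx
  exact ⟨hx 0, hx 1⟩

theorem conjMap_smul (t : ℝ) (a : ℂ) (y : L2) :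
    conjMap t (a • y) = (starRingEnd ℂ) a • conjMap t y := by
  refine ext_coord fun i => ?_
  filter_upwards [conjMap_ae t (a • y), conjMap_ae t y, coord_smul a y,
    coord_smul ((starRingEnd ℂ) a) (conjMap t y)] with x h1 h2 h3 h4
  fin_cases i
  · simp only [Fin.zero_eta]; rw [h1.1, h4, h2.1, h3, map_mul]
  · simp only [Fin.mk_one]; rw [h1.2, h4, h2.2, h3, map_mul]; ring

theorem conjMap_conjMap (t : ℝ) (y : L2) : conjMap t (conjMap t y) = (t : ℂ) • y := by
  refine ext_coord fun i => ?_
  filter_upwards [conjMap_ae t (conjMap t y), conjMap_ae t y, coord_smul (t : ℂ) y]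
    with x h1 h2 h3
  fin_cases i
  · simp only [Fin.zero_eta]; rw [h1.1, h2.2, h3]; simp
  · simp only [Fin.mk_one]; rw [h1.2, h2.1, h3]; simp

theorem conjMap_mem_graph {t : ℝ} {v : Potential} (hv : v ∈ classX t) {bc : BC} {y f : L2}
    (h : (y, f) ∈ (diracOp bc v).graph) :
    (conjMap t y, conjMap t f) ∈ (diracOp bc v).graph := by
  obtain ⟨u, g, H⟩ := mem_graph_iff.1 h
  have hσ : (starRingEnd ℂ) bc.sign = bc.sign := by cases bc <;> simp [BC.sign]
  refine mem_graph_iff.2 ⟨![fun x => (starRingEnd ℂ) (u 1 x), fun x => t * (starRingEnd ℂ) (u 0 x)],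
    ![fun x => (starRingEnd ℂ) (g 1 x), fun x => t * (starRingEnd ℂ) (g 0 x)],
    ⟨fun i => ?_, fun i => ?_, fun i => ?_, fun i => ?_⟩, ?_, ?_⟩
  · fin_cases i
    · exact (H.prim 1).conj
    · exact (H.prim 0).conj.const_mul _
  · fin_cases i
    · exact memLp_conj (H.memLp 1)
    · exact (memLp_conj (H.memLp 0)).const_mul _
  · fin_cases i
    · simp [H.boundary, hσ]
    · simp [H.boundary, hσ, mul_left_comm]
  · filter_upwards [conjMap_ae t y, ae_all_iff.2 H.ae_eq] with x h1 h2
    fin_cases i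
    · simp [h1.1, h2]
    · simp [h1.2, h2]
  · filter_upwards [conjMap_ae t f, H.snd, hv] with x h1 h2 h3
    rw [h1.1, h2, h3]
    simp only [Matrix.cons_val_zero, Matrix.cons_val_one, map_add, map_mul, map_neg,
      Complex.conj_I, Complex.conj_conj, Complex.conj_ofReal]
    ring
  · filter_upwards [conjMap_ae t f, H.fst, hv] with x h1 h2 h3
    rw [h1.2, h2, h3]
    simp only [Matrix.cons_val_zero, Matrix.cons_val_one, map_add, map_mul,
      Complex.conj_I]
    ring

/-! ### Smallness of the sandwiched potential `(L⁰ - z)⁻¹ V (L⁰ - z)⁻¹` -/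

/-- The potential whose entries `P`, `Q` are the coordinates of an element of `L²([0, π], ℂ²)`. -/
noncomputable def Potential.ofL2 (q : L2) : Potential :=
  ⟨(memLp_coord q 0).toLp _, (memLp_coord q 1).toLp _⟩

theorem Potential.distSq_ofL2 (q r : L2) :
    (Potential.ofL2 q).distSq (Potential.ofL2 r) = ‖q - r‖ ^ 2 := by
  rw [Potential.distSq, norm_sq_Lp, norm_sq_Lp, norm_sq_L2,
    ← integral_add (integrable_norm_sq (Lp.memLp _)) (integrable_norm_sq (Lp.memLp _))]
  refine integral_congr_ae ?_
  filter_upwards [coord_sub q r, Lp.coeFn_sub (ofL2 q).P (ofL2 r).P,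
    Lp.coeFn_sub (ofL2 q).Q (ofL2 r).Q, (memLp_coord q 0).coeFn_toLp,
    (memLp_coord q 1).coeFn_toLp, (memLp_coord r 0).coeFn_toLp, (memLp_coord r 1).coeFn_toLp]
    with x h1 h2 h3 h4 h5 h6 h7
  rw [h2, h3, h1, h1, Pi.sub_apply, Pi.sub_apply]
  simp only [ofL2] at *
  rw [h4, h5, h6, h7]

theorem Potential.exists_ofL2 (v : Potential) : ∃ q, v = Potential.ofL2 q := by
  have h : ∀ i, MemLp ((![v.P, v.Q] : Fin 2 → ℝ → ℂ) i) 2 intervalMeasure := by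
    intro i
    fin_cases i
    · exact Lp.memLp v.P
    · exact Lp.memLp v.Q
  refine ⟨ofCoord _ h, ?_⟩
  have hae := ofCoord_ae _ h
  obtain ⟨P, Q⟩ := v
  simp only [ofL2, Potential.mk.injEq]
  constructor
  · refine Lp.ext ?_
    filter_upwards [hae, (memLp_coord (ofCoord _ h) 0).coeFn_toLp] with x h1 h2
    rw [h2, h1]; rfl
  · refine Lp.ext ?_
    filter_upwards [hae, (memLp_coord (ofCoord _ h) 1).coeFn_toLp] with x h1 h2
    rw [h2, h1]; rfl

/-- For an absolutely continuous periodic potential, `V` anticommutes with `L⁰` up to the bounded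
term `D` made of the derivative of the potential: `(L⁰ - z) V y = -V (L⁰ - z) y - 2 z V y + D y`.
Applying the resolvent gains a factor `1 / |z|`. -/
theorem exists_resolvent_gain {q : L2} (hq : q ∈ domain .per) :
    ∃ C : ℝ, 0 ≤ C ∧ ∀ (bc : BC) (z : ℂ) (R₀ : L2 →L[ℂ] L2), 1 ≤ |z.im| →
      IsInverse (freeOp bc) z R₀ → (∀ f, ‖R₀ f‖ ≤ ‖f‖) → ∀ y f₀ f : L2,
      (y, f₀) ∈ (freeOp bc).graph → (y, f) ∈ (diracOp bc (Potential.ofL2 q)).graph →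
      ‖z‖ * ‖R₀ (f - f₀)‖ ≤ C * ‖f₀ - z • y‖ := by
  obtain ⟨us, gs, Hs⟩ := exists_rep hq
  obtain ⟨K₀, hK₀⟩ := isCompact_Icc.exists_bound_of_continuousOn (Hs.prim 0).continuousOn
  obtain ⟨K₁, hK₁⟩ := isCompact_Icc.exists_bound_of_continuousOn (Hs.prim 1).continuousOn
  set K := max K₀ K₁
  set G := ∫ x, (‖gs 0 x‖ ^ 2 + ‖gs 1 x‖ ^ 2) ∂intervalMeasure with hG
  have hG0 : 0 ≤ G := integral_nonneg fun x => by positivity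
  set d := (Potential.ofL2 q).distSq ⟨0, 0⟩
  have hd0 : 0 ≤ d := Potential.distSq_nonneg _ _
  refine ⟨Real.sqrt (10 * G + 2 * K ^ 2) + Real.sqrt (5 * d), by positivity, ?_⟩
  intro bc z R₀ hz hR₀ hRb y f₀ f h₀ hf
  have hpos : 0 < |z.im| := one_pos.trans_le hz
  have h5 : 5 / |z.im| ≤ 5 := by rw [div_le_iff₀ hpos]; linarith
  obtain ⟨u, g, H⟩ := mem_graph_iff.1 h₀
  have Hf := H.toRep.graphRep hf
  set F := f₀ - z • y with hF
  set p := f - f₀ with hp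
  have hu : ∀ i, ∀ x ∈ Icc 0 Real.pi, ‖u i x‖ ^ 2 ≤ 5 * ‖F‖ ^ 2 := fun i x hx =>
    (free_norm_sq_le H hz i hx).trans (by gcongr)
  have hqP := (memLp_coord q 0).coeFn_toLp
  have hqQ := (memLp_coord q 1).coeFn_toLp
  have hp' : Rep bc p ![fun x => us 0 x * u 1 x, fun x => us 1 x * u 0 x]
      ![fun x => gs 0 x * u 1 x + us 0 x * g 1 x, fun x => gs 1 x * u 0 x + us 1 x * g 0 x] := by
    have hmem (i j : Fin 2) : MemLp (fun x => gs i x * u j x + us i x * g j x) 2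
        intervalMeasure := by
      refine MemLp.add ?_ ?_
      · have := (H.prim j).memLp_top.mul (Hs.memLp i) (r := 2)
        exact this
      · have := (H.memLp j).mul (Hs.prim i).memLp_top (r := 2)
        exact this
    refine ⟨fun i => ?_, fun i => ?_, fun i => ?_, fun i => ?_⟩
    · fin_cases i
      · exact (Hs.prim 0).mul (H.prim 1)
      · exact (Hs.prim 1).mul (H.prim 0)
    · fin_cases i
      · exact hmem 0 1
      · exact hmem 1 0
    · fin_cases i <;> simp [Hs.boundary, H.boundary, BC.sign] <;> ring
    · filter_upwards [coord_sub f f₀, H.fst, H.snd, Hf.fst, Hf.snd, hqP, hqQ,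
        ae_all_iff.2 Hs.ae_eq, coeFn_zero_Lp] with x h1 h2 h3 h4 h5 h6 h7 h8 h9
      simp only [Potential.ofL2] at h4 h5
      fin_cases i
      · simp only [Fin.zero_eta, Matrix.cons_val_zero]
        rw [h1, h4, h2, h6, h8, h9]; ring
      · simp only [Fin.mk_one, Matrix.cons_val_one]
        rw [h1, h5, h3, h7, h8, h9]
        change _ = us 1 x * u 0 x
        ring
  obtain ⟨m, hm⟩ := (LinearPMap.mem_domain_iff (f := freeOp bc)).1 hp'.mem_domain
  have Hm := hp'.graphRep hm
  set e := m + z • p with he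
  have hpn : ‖p‖ ≤ Real.sqrt (5 * d) * ‖F‖ := by
    have h1 := norm_sq_sub_le_resolvent hz h₀ hf h₀
    refine abs_le_of_sq_le_sq' ?_ (by positivity) |>.2
    rw [mul_pow, Real.sq_sqrt (by positivity)]
    refine h1.trans ?_
    gcongr
  have hen : ‖e‖ ≤ Real.sqrt (10 * G + 2 * K ^ 2) * ‖F‖ := by
    refine abs_le_of_sq_le_sq' ?_ (by positivity) |>.2
    rw [mul_pow, Real.sq_sqrt (by positivity), norm_sq_L2]
    have hgi : Integrable (fun x => ‖gs 0 x‖ ^ 2 + ‖gs 1 x‖ ^ 2) intervalMeasure :=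
      (integrable_norm_sq (Hs.memLp 0)).add (integrable_norm_sq (Hs.memLp 1))
    have hFi : Integrable (fun x => ‖F x 0‖ ^ 2 + ‖F x 1‖ ^ 2) intervalMeasure :=
      (integrable_norm_sq (memLp_coord F 0)).add (integrable_norm_sq (memLp_coord F 1))
    calc ∫ x, (‖e x 0‖ ^ 2 + ‖e x 1‖ ^ 2) ∂intervalMeasure
        ≤ ∫ x, (10 * ‖F‖ ^ 2 * (‖gs 0 x‖ ^ 2 + ‖gs 1 x‖ ^ 2) +
          2 * K ^ 2 * (‖F x 0‖ ^ 2 + ‖F x 1‖ ^ 2)) ∂intervalMeasure := by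
          refine integral_mono_ae ((integrable_norm_sq (memLp_coord e 0)).add
            (integrable_norm_sq (memLp_coord e 1))) ((hgi.const_mul _).add (hFi.const_mul _)) ?_
          filter_upwards [coord_add m (z • p), coord_smul z p, ae_all_iff.2 hp'.ae_eq, Hm.fst,
            Hm.snd, H.free, coord_sub f₀ (z • y), coord_smul z y, ae_all_iff.2 H.ae_eq,
            coeFn_zero_Lp, ae_mem_Icc] with x h1 h2 h3 h4 h5 h6 h7 h8 h9 h10 hx
          have e0 : e x 0 = Complex.I * (gs 0 x * u 1 x) - us 0 x * F x 1 := by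
            rw [he, h1, h2, h3, h4, hF, h7, h8, h9, h10]
            simp only [Matrix.cons_val_zero, Matrix.cons_val_one]
            rw [h6.2]
            linear_combination (us 0 x * f₀ x 1) * Complex.I_mul_I
          have e1 : e x 1 = -Complex.I * (gs 1 x * u 0 x) - us 1 x * F x 0 := by
            rw [he, h1, h2, h3, h5, hF, h7, h8, h9, h10]
            simp only [Matrix.cons_val_zero, Matrix.cons_val_one]
            rw [h6.1]
            linear_combination (us 1 x * f₀ x 0) * Complex.I_mul_I
          have hest (a b c k : ℂ) (s : ℂ) (hs : ‖s‖ = 1) (hb : ‖b‖ ^ 2 ≤ 5 * ‖F‖ ^ 2)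
              (hc : ‖c‖ ≤ K) : ‖s * (a * b) - c * k‖ ^ 2 ≤
              10 * ‖F‖ ^ 2 * ‖a‖ ^ 2 + 2 * K ^ 2 * ‖k‖ ^ 2 := by
            have t1 : ‖s * (a * b) - c * k‖ ≤ ‖a‖ * ‖b‖ + ‖c‖ * ‖k‖ := by
              refine (norm_sub_le _ _).trans (le_of_eq ?_)
              simp only [norm_mul, hs, one_mul]
            have t2 : ‖s * (a * b) - c * k‖ ^ 2 ≤ (‖a‖ * ‖b‖ + ‖c‖ * ‖k‖) ^ 2 := by gcongr
            have t3 : ‖c‖ ^ 2 ≤ K ^ 2 := by gcongr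
            nlinarith [sq_nonneg (‖a‖ * ‖b‖ - ‖c‖ * ‖k‖),
              mul_le_mul_of_nonneg_right t3 (sq_nonneg ‖k‖),
              mul_le_mul_of_nonneg_right hb (sq_nonneg ‖a‖)]
          have b0 := hest (gs 0 x) (u 1 x) (us 0 x) (F x 1) Complex.I (by simp) (hu 1 x hx)
            ((hK₀ x hx).trans (le_max_left _ _))
          have b1 := hest (gs 1 x) (u 0 x) (us 1 x) (F x 0) (-Complex.I) (by simp) (hu 0 x hx)
            ((hK₁ x hx).trans (le_max_right _ _))
          simp only [e0, e1]
          linarith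
      _ = (10 * G + 2 * K ^ 2) * ‖F‖ ^ 2 := by
          rw [integral_add (hgi.const_mul _) (hFi.const_mul _), integral_const_mul,
            integral_const_mul, ← norm_sq_L2]
          ring
  have hRm := (hR₀ _ _).1 hm
  have h2z : (2 * z) • R₀ p = R₀ e - p := by
    rw [he, map_add, map_smul]
    rw [map_sub, map_smul] at hRm
    nth_rewrite 3 [← hRm]
    module
  have hn := congrArg norm h2z
  rw [norm_smul, norm_mul, Complex.norm_ofNat] at hn
  have h3 := norm_sub_le (R₀ e) p
  have h4 := hRb e
  have h6 : 0 ≤ ‖z‖ * ‖R₀ p‖ := by positivity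
  nlinarith

/-- On the line `im z = τ` the operators `(L⁰ - z)⁻¹ V (L⁰ - z)⁻¹` tend to zero as
`|re z| → ∞`: this is clear for absolutely continuous potentials, which are dense in `L²` because
the periodic free operator is densely defined. -/
theorem eventually_sandwich_small (v : Potential) {ε : ℝ} (hε : 0 < ε) :
    ∃ N : ℕ, ∀ (bc : BC) (z : ℂ) (R₀ : L2 →L[ℂ] L2), (N : ℝ) < ‖z‖ → 1 ≤ |z.im| →
      IsInverse (freeOp bc) z R₀ → (∀ f, ‖R₀ f‖ ≤ ‖f‖) → ∀ y f₀ f : L2,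
      (y, f₀) ∈ (freeOp bc).graph → (y, f) ∈ (diracOp bc v).graph →
      ‖R₀ (f - f₀)‖ ≤ ε * ‖f₀ - z • y‖ := by
  obtain ⟨q, rfl⟩ := v.exists_ofL2
  have hdense := (freeOp_isSelfAdjoint .per).1.dense_domain
  obtain ⟨r, hr, hqr⟩ := hdense.exists_dist_lt q (ε := ε / 6) (by positivity)
  obtain ⟨C, hC0, hC⟩ := exists_resolvent_gain (q := r) hr
  obtain ⟨N, hN⟩ := exists_nat_gt (2 * C / ε)
  refine ⟨N, fun bc z R₀ hzN hz hR₀ hRb y f₀ f h₀ hf => ?_⟩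
  have hpos : 0 < |z.im| := one_pos.trans_le hz
  obtain ⟨h, hh⟩ := (LinearPMap.mem_domain_iff (f := diracOp bc (Potential.ofL2 r))).1
    (LinearPMap.mem_domain_of_mem_graph (f := freeOp bc) h₀)
  have h1 := hC bc z R₀ hz hR₀ hRb y f₀ h h₀ hh
  have h2 := norm_sq_sub_le_resolvent hz h₀ hf hh
  rw [Potential.distSq_ofL2] at h2
  rw [dist_eq_norm] at hqr
  set F := f₀ - z • y
  have h3 : ‖f - h‖ ≤ ε / 2 * ‖F‖ := by
    refine abs_le_of_sq_le_sq' ?_ (by positivity) |>.2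
    have h5 : 5 / |z.im| ≤ 9 := by rw [div_le_iff₀ hpos]; linarith
    have h6 : ‖q - r‖ ^ 2 ≤ (ε / 6) ^ 2 := by gcongr
    calc ‖f - h‖ ^ 2 ≤ 9 * (ε / 6) ^ 2 * ‖F‖ ^ 2 := h2.trans (by gcongr)
      _ = _ := by ring
  have hz0 : 0 < ‖z‖ := (Nat.cast_nonneg N).trans_lt hzN
  have h4 : ‖R₀ (h - f₀)‖ ≤ ε / 2 * ‖F‖ := by
    have h7 : 2 * C ≤ ε * ‖z‖ := by
      rw [div_lt_iff₀ hε] at hN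
      nlinarith
    have : ‖z‖ * ‖R₀ (h - f₀)‖ ≤ ‖z‖ * (ε / 2 * ‖F‖) := by
      nlinarith [mul_le_mul_of_nonneg_right h7 (norm_nonneg F)]
    exact le_of_mul_le_mul_left this hz0
  have e : f - f₀ = (f - h) + (h - f₀) := by abel
  rw [e, map_add]
  calc _ ≤ ‖R₀ (f - h)‖ + ‖R₀ (h - f₀)‖ := norm_add_le _ _
    _ ≤ ‖f - h‖ + ‖R₀ (h - f₀)‖ := by gcongr; exact hRb _
    _ ≤ _ := by linarith

/-! ### Invariant subspaces of perturbed operators -/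

section Reduction

variable {E H : Type*} [NormedAddCommGroup E] [InnerProductSpace ℂ E]
  [NormedAddCommGroup H] [InnerProductSpace ℂ H]

/-- A functional, everywhere solvable and bounded linear relation is a bounded operator. -/
theorem exists_clm_of_relation (g : Submodule ℂ (H × H)) {M : ℝ}
    (hex : ∀ x, ∃ y, (x, y) ∈ g) (hb : ∀ x y, (x, y) ∈ g → ‖y‖ ≤ M * ‖x‖) :
    ∃ G : H →L[ℂ] H, (∀ x, (x, G x) ∈ g) ∧ ∀ x, ‖G x‖ ≤ M * ‖x‖ := by
  choose r hr using hex
  have huniq : ∀ x y, (x, y) ∈ g → r x = y := by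
    intro x y h
    have h1 := hb _ _ (g.sub_mem (hr x) h)
    simp only [sub_self, norm_zero, mul_zero] at h1
    exact sub_eq_zero.1 (norm_le_zero_iff.1 h1)
  let R : H →ₗ[ℂ] H :=
    { toFun := r
      map_add' := fun x y => huniq _ _ (g.add_mem (hr x) (hr y))
      map_smul' := fun a x => huniq _ _ (g.smul_mem a (hr x)) }
  exact ⟨R.mkContinuous M fun x => hb _ _ (hr x), hr, fun x => hb _ _ (hr x)⟩

variable [CompleteSpace H]

/-- Let `ι` embed an eigenspace of `A₀` at `α`, with spectral projection `ι ∘ p` and reduced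
resolvent `G`. If `A` is close to `A₀`, then a small deformation `Φ` of `ι` embeds an invariant
subspace of `A`. Writing `Φ = ι + X` with `p ∘ X = 0`, invariance is the Riccati equation
`X = G (X p - 1) (A - A₀) (ι + X)`, solved by contraction in the unit ball. -/
theorem exists_invariant_graph (ι : E →L[ℂ] H) (p : H →L[ℂ] E) (A₀ A G : H →L[ℂ] H) {α : ℂ}
    {M ε : ℝ} (hι : ‖ι‖ ≤ 1) (hp : ‖p‖ ≤ 1) (hpι : ∀ e, p (ι e) = e)
    (hAι : ∀ e, A₀ (ι e) = α • ι e) (hG : ∀ x, A₀ (G x) - α • G x = x - ι (p x))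
    (hpG : ∀ x, p (G x) = 0) (hGM : ‖G‖ ≤ M) (hA : ‖A - A₀‖ ≤ ε) (hMε : 8 * M * ε ≤ 1) :
    ∃ Φ : E →L[ℂ] H, (∀ e, p (Φ e) = e) ∧ ‖Φ‖ ≤ 2 ∧
      ∀ e, A (Φ e) = Φ (α • e + p ((A - A₀) (Φ e))) := by
  set D := A - A₀ with hD
  have hM0 : 0 ≤ M := (norm_nonneg G).trans hGM
  have hε0 : 0 ≤ ε := (norm_nonneg D).trans hA
  let Ψ : (E →L[ℂ] H) → (E →L[ℂ] H) := fun X =>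
    G ∘L ((X ∘L p - ContinuousLinearMap.id ℂ H) ∘L (D ∘L (ι + X)))
  have hXp (X : E →L[ℂ] H) : ‖X ∘L p‖ ≤ ‖X‖ := by
    calc _ ≤ ‖X‖ * ‖p‖ := ContinuousLinearMap.opNorm_comp_le _ _
      _ ≤ ‖X‖ * 1 := by gcongr
      _ = ‖X‖ := mul_one _
  have hcomp (Y : H →L[ℂ] H) (Z : E →L[ℂ] H) {a b : ℝ} (ha : ‖Y‖ ≤ a) (hb : ‖Z‖ ≤ b) :
      ‖G ∘L (Y ∘L (D ∘L Z))‖ ≤ M * (a * (ε * b)) := by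
    have ha0 : 0 ≤ a := (norm_nonneg Y).trans ha
    refine (ContinuousLinearMap.opNorm_comp_le _ _).trans ?_
    refine mul_le_mul hGM ?_ (norm_nonneg _) hM0
    refine (ContinuousLinearMap.opNorm_comp_le _ _).trans ?_
    refine mul_le_mul ha ?_ (norm_nonneg _) ha0
    refine (ContinuousLinearMap.opNorm_comp_le _ _).trans ?_
    exact mul_le_mul hA hb (norm_nonneg _) hε0
  have hone : ‖ContinuousLinearMap.id ℂ H‖ ≤ 1 := ContinuousLinearMap.norm_id_le
  have hleft (X : E →L[ℂ] H) (hX : ‖X‖ ≤ 1) : ‖X ∘L p - ContinuousLinearMap.id ℂ H‖ ≤ 2 := by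
    have := norm_sub_le (X ∘L p) (ContinuousLinearMap.id ℂ H)
    linarith [hXp X]
  have hright (X : E →L[ℂ] H) (hX : ‖X‖ ≤ 1) : ‖ι + X‖ ≤ 2 := by
    linarith [norm_add_le ι X]
  have hmaps : MapsTo Ψ (Metric.closedBall 0 1) (Metric.closedBall 0 1) := by
    intro X hX
    rw [mem_closedBall_zero_iff] at hX ⊢
    have := hcomp _ _ (hleft X hX) (hright X hX)
    change ‖G ∘L ((X ∘L p - ContinuousLinearMap.id ℂ H) ∘L (D ∘L (ι + X)))‖ ≤ 1
    linarith
  have hcontr : ContractingWith (1 / 2) (hmaps.restrict Ψ _ _) := by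
    refine ⟨by norm_num, LipschitzWith.of_dist_le_mul ?_⟩
    rintro ⟨X, hX⟩ ⟨Y, hY⟩
    rw [mem_closedBall_zero_iff] at hX hY
    rw [Subtype.dist_eq, Subtype.dist_eq, dist_eq_norm, dist_eq_norm]
    change ‖Ψ X - Ψ Y‖ ≤ _ * ‖X - Y‖
    have e : Ψ X - Ψ Y = G ∘L (((X - Y) ∘L p) ∘L (D ∘L (ι + X))) +
        G ∘L ((Y ∘L p - ContinuousLinearMap.id ℂ H) ∘L (D ∘L (X - Y))) := by
      ext e
      simp [Ψ]
      abel
    rw [e]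
    refine (norm_add_le _ _).trans ?_
    have h1 := hcomp _ _ (hXp (X - Y)) (hright X hX)
    have h2 := hcomp (Y ∘L p - ContinuousLinearMap.id ℂ H) (X - Y) (hleft Y hY) le_rfl
    have h3 : 8 * M * ε * ‖X - Y‖ ≤ 1 * ‖X - Y‖ := by gcongr
    push_cast
    linarith
  obtain ⟨X, hXmem, hX, -⟩ := hcontr.exists_fixedPoint' Metric.isClosed_closedBall.isComplete hmaps
    (x := 0) (by simp) (edist_ne_top _ _)
  rw [mem_closedBall_zero_iff] at hXmem
  have hXe (e : E) : X e = G (X (p (D (ι e + X e))) - D (ι e + X e)) :=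
    (DFunLike.congr_fun hX e).symm
  have hpX (e : E) : p (X e) = 0 := by rw [hXe, hpG]
  refine ⟨ι + X, fun e => ?_, hright X hXmem, fun e => ?_⟩
  · simp [hpι, hpX]
  · have h1 := hG (X (p (D (ι e + X e))) - D (ι e + X e))
    rw [← hXe, map_sub p, hpX, zero_sub, map_neg] at h1
    have h2 : A (ι e + X e) = A₀ (ι e + X e) + D (ι e + X e) := by simp [hD]
    have h3 : A₀ (X e) = X (p (D (ι e + X e))) - D (ι e + X e) + ι (p (D (ι e + X e))) +
        α • X e := by
      rw [sub_eq_iff_eq_add] at h1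
      rw [h1]; abel
    simp only [add_apply]
    rw [h2, map_add A₀, hAι, h3]
    generalize D (ι e + X e) = d
    rw [map_add ι, map_add X, map_smul, map_smul]
    module

set_option maxHeartbeats 1000000 in
/-- Let `l` be an isolated eigenvalue of the symmetric operator `T₀`, with eigenspace `ι E`, and let
the resolvents of `T` and `T₀` at `l + iτ` be close. Then `T` has an invariant subspace `Φ E`, on
which it acts by an operator `C` whose spectrum lies in the disc `|z - l| < 1 / 4`, and the
quotient operator has no eigenvalues in this disc. -/
theorem exists_invariant_subspace [CompleteSpace E] {T₀ T : H →ₗ.[ℂ] H} (hT₀ : IsSymm T₀)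
    (ι : E →ₗᵢ[ℂ] H) {l : ℝ}
    (hι : ∀ e, (ι e, (l : ℂ) • ι e) ∈ T₀.graph)
    (hgap : ∀ y f, (y, f) ∈ T₀.graph → (∀ e, inner ℂ (ι e) y = 0) →
      3 / 10 * ‖y‖ ≤ ‖f - (l : ℂ) • y‖)
    (hsolv : ∀ f, (∀ e, inner ℂ (ι e) f = 0) → ∃ y, (y, f + (l : ℂ) • y) ∈ T₀.graph)
    {τ : ℝ} (hτ : 1 ≤ τ) {A₀ A : H →L[ℂ] H} (hA₀ : IsInverse T₀ (l + Complex.I * τ) A₀)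
    (hA : IsInverse T (l + Complex.I * τ) A)
    (hclose : ∀ x, ‖A x - A₀ x‖ ≤ 1 / (100 * τ ^ 2) * ‖x‖) :
    ∃ (Φ : E →ₗ[ℂ] H) (C : Module.End ℂ E), Function.Injective Φ ∧
      (∀ e, (Φ e, Φ (C e)) ∈ T.graph) ∧
      (∀ ζ, C.HasEigenvalue ζ → ζ ∈ Metric.ball (l : ℂ) (1 / 4)) ∧
      ∀ z ∈ Metric.ball (l : ℂ) (1 / 4), ∀ y f, (y, f) ∈ T.graph →
        f - z • y ∈ LinearMap.range Φ → y ∈ LinearMap.range Φ := by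
  have hτ0 : 0 < τ := one_pos.trans_le hτ
  have hτc : (τ : ℂ) ≠ 0 := by exact_mod_cast hτ0.ne'
  set z₀ : ℂ := l + Complex.I * τ with hz₀
  -- `α = 1 / (l - z₀)`
  set α : ℂ := Complex.I / τ with hα
  have hα0 : α ≠ 0 := div_ne_zero Complex.I_ne_zero hτc
  have hαz : α * ((l : ℂ) - z₀) = 1 := by
    rw [hα, hz₀]; field_simp; linear_combination (-τ : ℂ) * Complex.I_mul_I
  have hαn : ‖α‖ = 1 / τ := by
    rw [hα, norm_div, Complex.norm_I, Complex.norm_real, Real.norm_of_nonneg hτ0.le]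
  have hlz : ‖(l : ℂ) - z₀‖ = τ := by
    rw [hz₀]; simp [abs_of_pos hτ0]
  set ι' : E →L[ℂ] H := ι.toContinuousLinearMap with hι'
  set p : H →L[ℂ] E := ContinuousLinearMap.adjoint ι' with hp
  have hι1 : ‖ι'‖ ≤ 1 := ι.norm_toContinuousLinearMap_le
  have hp1 : ‖p‖ ≤ 1 := by rw [hp, LinearIsometryEquiv.norm_map]; exact hι1
  have hpin (e : E) (x : H) : inner ℂ e (p x) = inner ℂ (ι e) x :=
    ContinuousLinearMap.adjoint_inner_right ι' e x
  have hpι (e : E) : p (ι' e) = e := by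
    refine ext_inner_left ℂ fun e' => ?_
    rw [hpin]; exact ι.inner_map_map e' e
  have hp0 (x : H) : p x = 0 ↔ ∀ e, inner ℂ (ι e) x = 0 := by
    constructor
    · intro h e; rw [← hpin, h, inner_zero_right]
    · intro h
      refine ext_inner_left ℂ fun e' => ?_
      rw [hpin, h, inner_zero_right]
  have hAι (e : E) : A₀ (ι' e) = α • ι' e := by
    have h1 := (hA₀ _ _).1 (hι e)
    rw [← sub_smul, map_smul] at h1
    calc A₀ (ι e) = (α * ((l : ℂ) - z₀)) • A₀ (ι e) := by rw [hαz, one_smul]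
      _ = α • ι e := by rw [mul_smul, h1]
  have hpA (x : H) : p (A₀ x) = α • p x := by
    refine ext_inner_left ℂ fun e => ?_
    have h1 := hT₀ _ _ _ _ (hι e) (hA₀.mem_graph x)
    rw [inner_smul_left, inner_add_right, inner_smul_right, Complex.conj_ofReal] at h1
    rw [inner_smul_right, hpin, hpin]
    linear_combination (-inner ℂ (ι e) (A₀ x)) * hαz + α * h1
  -- the reduced resolvent, as the relation `x - ι (p x) = (A₀ - α) y`, `p y = 0`
  let rel : Submodule ℂ (H × H) :=
    { carrier := {q | A₀ q.2 - α • q.2 = q.1 - ι' (p q.1) ∧ p q.2 = 0}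
      add_mem' := by
        rintro ⟨a, b⟩ ⟨c, d⟩ ⟨h1, h2⟩ ⟨h3, h4⟩
        refine ⟨?_, ?_⟩
        · simp only [Prod.mk_add_mk, map_add, smul_add] at h1 h3 ⊢
          rw [add_sub_add_comm, h1, h3]; abel
        · simp only [Prod.mk_add_mk, map_add] at h2 h4 ⊢
          rw [h2, h4, add_zero]
      zero_mem' := by simp
      smul_mem' := by
        rintro a ⟨b, c⟩ ⟨h1, h2⟩
        refine ⟨?_, ?_⟩
        · simp only [Prod.smul_mk, map_smul] at h1 ⊢
          rw [smul_comm α a, ← smul_sub, h1, smul_sub]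
        · simp only [Prod.smul_mk, map_smul] at h2 ⊢
          rw [h2, smul_zero] }
  have hpq (x : H) : p (x - ι' (p x)) = 0 := by rw [map_sub, hpι, sub_self]
  have hqn (x : H) : ‖x - ι' (p x)‖ ≤ 2 * ‖x‖ := by
    have h1 : ‖ι' (p x)‖ ≤ ‖x‖ := by
      change ‖ι (p x)‖ ≤ ‖x‖
      rw [ι.norm_map]
      exact (p.le_of_opNorm_le hp1 x).trans (by rw [one_mul])
    linarith [norm_sub_le x (ι' (p x))]
  obtain ⟨G, hG, hGn⟩ := exists_clm_of_relation rel (M := 10 * τ ^ 2) (fun x => by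
      obtain ⟨y₁, hy₁⟩ := hsolv _ ((hp0 _).1 (hpq x))
      -- `y` solves `(T₀ - l) y = x - ι (p x)` and is orthogonal to the eigenspace
      set y := y₁ - ι' (p y₁) with hy
      have hyg : (y, x - ι' (p x) + (l : ℂ) • y) ∈ T₀.graph := by
        have := T₀.graph.sub_mem hy₁ (hι (p y₁))
        convert! this using 1
        simp only [Prod.mk_sub_mk, hy, smul_sub]
        congr 1
        change _ = x - ι' (p x) + (l : ℂ) • y₁ - (l : ℂ) • ι' (p y₁)
        abel
      have hAy := (hA₀ _ _).1 hyg
      rw [add_sub_assoc, ← sub_smul, map_add, map_smul] at hAy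
      have hpy : p y = 0 := hpq y₁
      refine ⟨-(((l : ℂ) - z₀) • (x - ι' (p x) + ((l : ℂ) - z₀) • y)), ?_, ?_⟩
      · simp only
        set k := x - ι' (p x)
        have e : A₀ (k + ((l : ℂ) - z₀) • y) = y := by rw [map_add, map_smul, hAy]
        rw [map_neg, map_smul, e, smul_neg, smul_smul, hαz, one_smul]
        abel
      · simp only
        rw [map_neg, map_smul, map_add, hpq, map_smul, hpy]; simp)
    (fun x y ⟨h1, h2⟩ => by
      simp only at h1 h2
      -- `w = A₀ y` satisfies `(T₀ - l) w = -(l - z₀) (x - ι (p x))`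
      have h3 := hA₀.mem_graph y
      have h4 : p (A₀ y) = 0 := by rw [hpA, h2, smul_zero]
      have h5 := hgap _ _ h3 ((hp0 _).1 h4)
      have hy : y = ((l : ℂ) - z₀) • A₀ y - ((l : ℂ) - z₀) • (x - ι' (p x)) := by
        rw [← smul_sub, ← h1, sub_sub_cancel, smul_smul, mul_comm, hαz, one_smul]
      have h6 : y + z₀ • A₀ y - (l : ℂ) • A₀ y = -(((l : ℂ) - z₀) • (x - ι' (p x))) := by
        nth_rewrite 1 [hy]
        module
      rw [h6, norm_neg, norm_smul, hlz] at h5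
      have h7 : ‖y‖ ≤ τ * ‖A₀ y‖ + τ * ‖x - ι' (p x)‖ := by
        calc ‖y‖ = ‖((l : ℂ) - z₀) • A₀ y - ((l : ℂ) - z₀) • (x - ι' (p x))‖ := by rw [← hy]
          _ ≤ _ := norm_sub_le _ _
          _ = _ := by rw [norm_smul, norm_smul, hlz]
      have h8 := hqn x
      have h9 : ‖A₀ y‖ ≤ 20 / 3 * τ * ‖x‖ := by nlinarith
      have h10 : τ * ‖x‖ ≤ τ ^ 2 * ‖x‖ := by
        have : τ ≤ τ ^ 2 := by nlinarith
        gcongr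
      have h11 : τ * ‖A₀ y‖ ≤ τ * (20 / 3 * τ * ‖x‖) := by gcongr
      have h12 : τ * ‖x - ι' (p x)‖ ≤ τ * (2 * ‖x‖) := by gcongr
      linarith [mul_nonneg (sq_nonneg τ) (norm_nonneg x)])
  set ε : ℝ := 1 / (100 * τ ^ 2) with hε
  have hε0 : 0 < ε := by positivity
  have hετ : ε * τ ^ 2 = 1 / 100 := by rw [hε]; field_simp
  have hAn : ‖A - A₀‖ ≤ ε := ContinuousLinearMap.opNorm_le_bound _ hε0.le hclose
  obtain ⟨Φ, hpΦ, hΦ2, hinv⟩ := exists_invariant_graph ι' p A₀ A G hι1 hp1 hpι hAι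
    (fun x => (hG x).1) (fun x => (hG x).2)
    (G.opNorm_le_bound (by positivity) hGn) hAn (by nlinarith)
  set D := A - A₀ with hD
  have hΦn (e : E) : ‖Φ e‖ ≤ 2 * ‖e‖ := Φ.le_of_opNorm_le hΦ2 e
  have hDn (x : H) : ‖D x‖ ≤ ε * ‖x‖ := D.le_of_opNorm_le hAn x
  have hpn (x : H) : ‖p x‖ ≤ ‖x‖ := by simpa using p.le_of_opNorm_le hp1 x
  have hKn (e : E) : ‖p (D (Φ e))‖ ≤ 2 * ε * ‖e‖ := by
    calc _ ≤ ‖D (Φ e)‖ := hpn _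
      _ ≤ ε * ‖Φ e‖ := hDn _
      _ ≤ ε * (2 * ‖e‖) := by gcongr; exact hΦn e
      _ = _ := by ring
  -- `A Φ = Φ B` with `B = α U`, and `C = z₀ + B⁻¹`
  obtain ⟨U, hU⟩ := exists_unit_one_add (W := α⁻¹ • (p ∘L D ∘L Φ)) (by
    have h1 : ‖p ∘L D ∘L Φ‖ ≤ 2 * ε := ContinuousLinearMap.opNorm_le_bound _ (by positivity) hKn
    rw [norm_smul, norm_inv, hαn, one_div, inv_inv]
    calc τ * ‖p ∘L D ∘L Φ‖ ≤ τ * (2 * ε) := by gcongr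
      _ ≤ 2 * (ε * τ ^ 2) := by nlinarith [mul_le_mul_of_nonneg_left hτ (mul_pos hε0 hτ0).le]
      _ < 1 := by rw [hετ]; norm_num)
  have hUi (e : E) : U.1 (U⁻¹.1 e) = e := by
    rw [← mul_apply_eq_comp, U.mul_inv]; rfl
  have hB (e : E) : α • U.1 e = α • e + p (D (Φ e)) := by
    rw [hU]
    change α • (e + α⁻¹ • p (D (Φ e))) = _
    rw [smul_add, smul_smul, mul_inv_cancel₀ hα0, one_smul]
  let C : E →L[ℂ] E := z₀ • ContinuousLinearMap.id ℂ E + α⁻¹ • U⁻¹.1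
  have hC (e : E) : C e = z₀ • e + α⁻¹ • U⁻¹.1 e := rfl
  refine ⟨Φ, C, fun a b hab => ?_, fun e => ?_, fun ζ hζ => ?_, fun z hz y f hyf hr => ?_⟩
  · have : p (Φ a) = p (Φ b) := congrArg p hab
    rwa [hpΦ, hpΦ] at this
  · have h1 := hinv (α⁻¹ • U⁻¹.1 e)
    rw [← hB, map_smul U.1, hUi, smul_smul, mul_inv_cancel₀ hα0, one_smul] at h1
    have h2 := hA.mem_graph (Φ (α⁻¹ • U⁻¹.1 e))
    rw [h1] at h2
    convert! h2 using 2
    change Φ (C e) = _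
    rw [hC, map_add, map_smul]; abel
  · obtain ⟨e, he⟩ := hζ.exists_hasEigenvector
    have h1 : C e = ζ • e := he.apply_eq_smul
    have he0 : 0 < ‖e‖ := norm_pos_iff.2 he.2
    rw [hC] at h1
    have h2 : U⁻¹.1 e = (α * (ζ - z₀)) • e := by
      have : α⁻¹ • U⁻¹.1 e = (ζ - z₀) • e := by rw [sub_smul, ← h1]; abel
      rw [mul_smul, ← this, smul_smul, mul_inv_cancel₀ hα0, one_smul]
    have h3 : e = (ζ - z₀) • (α • e + p (D (Φ e))) := by
      rw [← hB, smul_smul, mul_comm, ← map_smul, ← h2, hUi]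
    have h4 : (α * (ζ - l)) • e = -((ζ - z₀) • p (D (Φ e))) := by
      have h5 : (α * (ζ - l)) • e = ((ζ - z₀) * α - α * ((l : ℂ) - z₀)) • e := by
        congr 1; ring
      rw [h5, hαz, sub_smul, one_smul]
      nth_rewrite 2 [h3]
      rw [smul_add, smul_smul]; abel
    have h5 := congrArg norm h4
    rw [norm_smul, norm_mul, hαn, norm_neg, norm_smul] at h5
    have h6 : ‖ζ - z₀‖ ≤ ‖ζ - l‖ + τ := by
      calc ‖ζ - z₀‖ = ‖(ζ - l) + (l - z₀)‖ := by congr 1; ring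
        _ ≤ _ := norm_add_le _ _
        _ = _ := by rw [hlz]
    have h7 : 1 / τ * ‖ζ - l‖ * ‖e‖ ≤ (‖ζ - l‖ + τ) * (2 * ε) * ‖e‖ := by
      rw [h5, mul_assoc]
      exact mul_le_mul h6 (hKn e) (norm_nonneg _) (by positivity)
    have h8 := le_of_mul_le_mul_right h7 he0
    have h9 : ‖ζ - l‖ ≤ (‖ζ - l‖ + τ) * (2 * ε) * τ := by
      calc ‖ζ - l‖ = 1 / τ * ‖ζ - l‖ * τ := by field_simp
        _ ≤ _ := by gcongr
    have h10 : ε * τ ≤ 1 / 100 := by nlinarith [mul_pos hε0 hτ0]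
    rw [Metric.mem_ball, dist_eq_norm]
    nlinarith [norm_nonneg (ζ - (l : ℂ))]
  · obtain ⟨e, he⟩ := hr
    rw [Metric.mem_ball, dist_eq_norm] at hz
    have hzz₀ : ‖z - z₀‖ ≤ 5 / 4 * τ := by
      calc ‖z - z₀‖ = ‖(z - l) + (l - z₀)‖ := by congr 1; ring
        _ ≤ _ := norm_add_le _ _
        _ ≤ _ := by rw [hlz]; linarith
    have hAy := (hA _ _).1 hyf
    set k := y - Φ (p y) with hk
    have hpk : p k = 0 := by rw [hk, map_sub, hpΦ, sub_self]
    suffices hk0 : k = 0 from ⟨p y, (sub_eq_zero.1 hk0).symm⟩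
    -- `k - (z - z₀) A k` lies in the range of `Φ`
    obtain ⟨e', he'⟩ : ∃ e', k - (z - z₀) • A k = Φ e' := by
      have h1 : y - (z - z₀) • A y = A (Φ e) := by
        change Φ e = _ at he
        rw [he, map_sub, map_smul]
        rw [map_sub, map_smul] at hAy
        nth_rewrite 1 [← hAy]
        module
      refine ⟨α • e + p (D (Φ e)) - p y + (z - z₀) • (α • p y + p (D (Φ (p y)))), ?_⟩
      rw [map_add, map_smul, map_sub Φ, ← hinv, ← hinv, ← h1, hk, map_sub A]
      module
    have hAk : A k = A₀ k + D k := by simp [hD]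
    have he'2 : e' = -((z - z₀) • p (D k)) := by
      rw [← hpΦ e', ← he', map_sub, map_smul, hpk, hAk, map_add, hpA, hpk]
      simp
    have h1 : k - (z - z₀) • A₀ k = (z - z₀) • D k - Φ ((z - z₀) • p (D k)) := by
      have : Φ ((z - z₀) • p (D k)) = -Φ e' := by rw [he'2, map_neg, neg_neg]
      rw [this, ← he', hAk]; module
    have h2 : ‖k - (z - z₀) • A₀ k‖ ≤ 15 / 4 * τ * ε * ‖k‖ := by
      rw [h1]
      have t1 : ‖(z - z₀) • D k‖ ≤ 5 / 4 * τ * (ε * ‖k‖) := by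
        rw [norm_smul]; exact mul_le_mul hzz₀ (hDn k) (norm_nonneg _) (by positivity)
      have t2 : ‖Φ ((z - z₀) • p (D k))‖ ≤ 2 * (5 / 4 * τ * (ε * ‖k‖)) := by
        refine (hΦn _).trans ?_
        rw [norm_smul]
        gcongr
        exact (hpn _).trans (hDn k)
      linarith [norm_sub_le ((z - z₀) • D k) (Φ ((z - z₀) • p (D k)))]
    -- the spectral gap of `T₀`, applied to `A₀ k`
    have h3 := hA₀.mem_graph k
    have h4 := hgap _ _ h3 ((hp0 _).1 (by rw [hpA, hpk, smul_zero]))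
    have h5 : k + z₀ • A₀ k - (l : ℂ) • A₀ k = (k - (z - z₀) • A₀ k) + (z - l) • A₀ k := by module
    rw [h5] at h4
    have h6 := norm_add_le (k - (z - z₀) • A₀ k) ((z - (l : ℂ)) • A₀ k)
    rw [norm_smul] at h6
    have h7 : ‖z - (l : ℂ)‖ * ‖A₀ k‖ ≤ 1 / 4 * ‖A₀ k‖ := by gcongr
    have h8 : ‖k‖ ≤ ‖k - (z - z₀) • A₀ k‖ + ‖z - z₀‖ * ‖A₀ k‖ := by
      rw [← norm_smul]
      calc ‖k‖ = ‖(k - (z - z₀) • A₀ k) + (z - z₀) • A₀ k‖ := by rw [sub_add_cancel]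
        _ ≤ _ := norm_add_le _ _
    have h9 : ‖z - z₀‖ * ‖A₀ k‖ ≤ 5 / 4 * τ * ‖A₀ k‖ := by gcongr
    have h10 : ‖A₀ k‖ ≤ 20 * (15 / 4 * τ * ε * ‖k‖) := by linarith
    have h11 : τ * ‖A₀ k‖ ≤ 75 * (ε * τ ^ 2) * ‖k‖ := by
      linarith [mul_le_mul_of_nonneg_left h10 hτ0.le]
    have h12 : τ * ε * ‖k‖ ≤ (ε * τ ^ 2) * ‖k‖ := by
      have : τ * ε ≤ ε * τ ^ 2 := by nlinarith [mul_pos hε0 hτ0]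
      gcongr
    rw [hετ] at h11 h12
    have h13 : ‖k‖ ≤ 0 := by linarith
    exact norm_le_zero_iff.1 h13

end Reduction

/-! ### Root subspaces inside an invariant subspace -/

section RootSubspace

variable {E H : Type*} [NormedAddCommGroup H] [InnerProductSpace ℂ H] [AddCommGroup E] [Module ℂ E]

theorem mem_kerPow_succ {T : H →ₗ.[ℂ] H} {z : ℂ} {k : ℕ} {y : H} :
    y ∈ kerPow T z (k + 1) ↔ ∃ f, (y, f) ∈ T.graph ∧ f - z • y ∈ kerPow T z k := by
  simp only [kerPow, Submodule.mem_map, Submodule.mem_comap]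
  constructor
  · rintro ⟨x, hx, rfl⟩
    exact ⟨T x, T.mem_graph x, hx⟩
  · rintro ⟨f, hf, hk⟩
    obtain ⟨x, rfl, rfl⟩ := (LinearPMap.mem_graph_iff T).1 hf
    exact ⟨x, hk, rfl⟩

theorem mem_kerPow_one {T : H →ₗ.[ℂ] H} {z : ℂ} {y : H} :
    y ∈ kerPow T z 1 ↔ (y, z • y) ∈ T.graph := by
  rw [mem_kerPow_succ]
  constructor
  · rintro ⟨f, hf, h0⟩
    have : f = z • y := sub_eq_zero.1 ((Submodule.mem_bot ℂ).1 h0)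
    rwa [this] at hf
  · intro h
    refine ⟨_, h, ?_⟩
    rw [sub_self]
    exact Submodule.zero_mem _

theorem kerPow_le_rootSubspace (T : H →ₗ.[ℂ] H) (z : ℂ) (k : ℕ) :
    kerPow T z k ≤ rootSubspace T z := le_iSup (kerPow T z) k

/-- A nonzero root subspace contains an eigenvector. -/
theorem exists_eigenvector {T : H →ₗ.[ℂ] H} {z : ℂ} (h : algMult T z ≠ 0) :
    ∃ y ≠ 0, (y, z • y) ∈ T.graph := by
  by_contra! hno
  refine h ?_
  have h0 : ∀ k, kerPow T z k = ⊥ := by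
    intro k
    induction k with
    | zero => rfl
    | succ k ih =>
      rw [Submodule.eq_bot_iff]
      intro y hy
      obtain ⟨f, hf, h0⟩ := mem_kerPow_succ.1 hy
      rw [ih, Submodule.mem_bot, sub_eq_zero] at h0
      by_contra hy0
      exact hno y hy0 (by rwa [h0] at hf)
  have : rootSubspace T z = ⊥ := by simp [rootSubspace, h0]
  rw [algMult, this]
  simp

theorem algMult_ne_zero {T : H →ₗ.[ℂ] H} {z : ℂ} {y : H} (hy : y ≠ 0)
    (h : (y, z • y) ∈ T.graph) : algMult T z ≠ 0 := by
  intro h0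
  have hb : rootSubspace T z = ⊥ := Submodule.rank_eq_zero.1 h0
  have := kerPow_le_rootSubspace T z 1 (mem_kerPow_one.2 h)
  rw [hb] at this
  exact hy ((Submodule.mem_bot ℂ).1 this)

theorem geomMult_le_algMult (T : H →ₗ.[ℂ] H) (z : ℂ) : geomMult T z ≤ algMult T z :=
  Submodule.rank_mono (kerPow_le_rootSubspace T z 1)

/-- If `T - z` has no kernel in the quotient by the invariant subspace `Φ E`, then the root subspace
of `T` at `z` is the one of the restriction of `T` to `Φ E`. -/
theorem algMult_eq_rootMultiplicity [Module.Finite ℂ E] {T : H →ₗ.[ℂ] H} {Φ : E →ₗ[ℂ] H}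
    {C : Module.End ℂ E}
    (hΦ : Function.Injective Φ) (hC : ∀ e, (Φ e, Φ (C e)) ∈ T.graph) {z : ℂ}
    (hz : ∀ y f, (y, f) ∈ T.graph → f - z • y ∈ LinearMap.range Φ → y ∈ LinearMap.range Φ) :
    algMult T z = (C.charpoly.rootMultiplicity z : ℕ) := by
  have hk : ∀ k : ℕ, kerPow T z k = (C.genEigenspace z k).map Φ := by
    intro k
    induction k with
    | zero => simp [kerPow]
    | succ k ih =>
      ext y
      rw [mem_kerPow_succ, ih]
      simp only [Submodule.mem_map, Module.End.mem_genEigenspace_nat, LinearMap.mem_ker]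
      constructor
      · rintro ⟨f, hf, e', he', hee⟩
        obtain ⟨e, rfl⟩ := hz _ _ hf ⟨e', hee⟩
        refine ⟨e, ?_, rfl⟩
        have h1 : Φ (C e) = f := LinearPMap.mem_graph_snd_inj T (hC e) hf rfl
        rw [← h1, ← map_smul, ← map_sub] at hee
        have h2 := hΦ hee
        rw [pow_succ, Module.End.mul_apply]
        simpa [h2] using he'
      · rintro ⟨e, he, rfl⟩
        refine ⟨_, hC e, C e - z • e, ?_, by rw [map_sub, map_smul]⟩
        rw [pow_succ, Module.End.mul_apply] at he
        simpa using he
  have hroot : rootSubspace T z = (C.maxGenEigenspace z).map Φ := by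
    rw [rootSubspace, ← Module.End.iSup_genEigenspace_eq, Submodule.map_iSup]
    simp only [hk]
  rw [algMult, hroot, ← C.finrank_maxGenEigenspace_eq z, ← Module.finrank_eq_rank,
    (Submodule.equivMapOfInjective Φ hΦ (C.maxGenEigenspace z)).finrank_eq]

end RootSubspace

/-! ### The eigenspaces of the free operator and its spectral gap -/

theorem exp_int_mul_pi (n : ℤ) : Complex.exp (Complex.I * n * Real.pi) = (bcOf n).sign := by
  unfold bcOf
  split_ifs with h
  · obtain ⟨k, rfl⟩ := h
    rw [BC.sign, Complex.exp_eq_one_iff]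
    exact ⟨k, by push_cast; ring⟩
  · obtain ⟨k, rfl⟩ := Int.not_even_iff_odd.1 h
    have : Complex.I * ((2 * k + 1 : ℤ) : ℂ) * Real.pi =
        k * (2 * Real.pi * Complex.I) + Real.pi * Complex.I := by push_cast; ring
    rw [this, Complex.exp_add, Complex.exp_int_mul_two_pi_mul_I, Complex.exp_pi_mul_I, one_mul,
      BC.sign]

theorem bcOf_neg (n : ℤ) : bcOf (-n) = bcOf n := by simp [bcOf]

/-- The coordinates of the normalized eigenfunctions of the free operator at `n`. -/
noncomputable def expCoord (n : ℤ) (c : C2) : Fin 2 → ℝ → ℂ :=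
  ![fun x => ((Real.sqrt Real.pi)⁻¹ * c 0) * Complex.exp (-Complex.I * n * x),
    fun x => ((Real.sqrt Real.pi)⁻¹ * c 1) * Complex.exp (Complex.I * n * x)]

theorem hasPrim_expCoord (n : ℤ) (c : C2) (i : Fin 2) : HasPrim (expCoord n c i)
    ((![fun x => (-Complex.I * n) * expCoord n c 0 x,
      fun x => (Complex.I * n) * expCoord n c 1 x] : Fin 2 → ℝ → ℂ) i) := by
  fin_cases i
  · refine ((HasPrim.exp (-Complex.I * n)).const_mul ((Real.sqrt Real.pi)⁻¹ * c 0)).congr_deriv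
      (Filter.Eventually.of_forall fun x => ?_)
    simp only [expCoord, Matrix.cons_val_zero]
    change _ = (-Complex.I * n) * (_ * _)
    ring
  · refine ((HasPrim.exp (Complex.I * n)).const_mul ((Real.sqrt Real.pi)⁻¹ * c 1)).congr_deriv
      (Filter.Eventually.of_forall fun x => ?_)
    simp only [expCoord]
    change _ = (Complex.I * n) * (_ * _)
    ring

theorem norm_exp_int (n : ℤ) (x : ℝ) : ‖Complex.exp (Complex.I * n * x)‖ = 1 := by
  rw [Complex.norm_exp]; simp

theorem norm_exp_neg_int (n : ℤ) (x : ℝ) : ‖Complex.exp (-Complex.I * n * x)‖ = 1 := by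
  rw [Complex.norm_exp]; simp

/-- The isometric embedding of `ℂ²` onto the eigenspace of the free operator at `n`. -/
noncomputable def expIso (n : ℤ) : C2 →ₗᵢ[ℂ] L2 where
  toFun c := ofCoord (expCoord n c) fun i => (hasPrim_expCoord n c i).memLp_two
  map_add' c d := by
    refine ext_coord fun i => ?_
    filter_upwards [ofCoord_ae (expCoord n (c + d)) fun i => (hasPrim_expCoord n _ i).memLp_two,
      ofCoord_ae (expCoord n c) fun i => (hasPrim_expCoord n _ i).memLp_two,
      ofCoord_ae (expCoord n d) fun i => (hasPrim_expCoord n _ i).memLp_two,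
      coord_add (ofCoord (expCoord n c) fun i => (hasPrim_expCoord n _ i).memLp_two)
        (ofCoord (expCoord n d) fun i => (hasPrim_expCoord n _ i).memLp_two)] with x h1 h2 h3 h4
    rw [h1, h4, h2, h3]
    fin_cases i <;> simp [expCoord] <;> ring
  map_smul' a c := by
    refine ext_coord fun i => ?_
    filter_upwards [ofCoord_ae (expCoord n (a • c)) fun i => (hasPrim_expCoord n _ i).memLp_two,
      ofCoord_ae (expCoord n c) fun i => (hasPrim_expCoord n _ i).memLp_two,
      coord_smul a (ofCoord (expCoord n c) fun i => (hasPrim_expCoord n _ i).memLp_two)]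
      with x h1 h2 h3
    rw [h1, RingHom.id_apply, h3, h2]
    fin_cases i <;> simp [expCoord] <;> ring
  norm_map' c := by
    change ‖ofCoord (expCoord n c) fun i => (hasPrim_expCoord n c i).memLp_two‖ = ‖c‖
    rw [← sq_eq_sq₀ (norm_nonneg _) (norm_nonneg _), norm_sq_L2, EuclideanSpace.norm_sq_eq,
      Fin.sum_univ_two]
    have hs : (Real.sqrt Real.pi) ^ 2 = Real.pi := Real.sq_sqrt Real.pi_pos.le
    have hs0 : Real.sqrt Real.pi ≠ 0 := (Real.sqrt_pos.2 Real.pi_pos).ne'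
    have : ∀ᵐ x ∂intervalMeasure,
        ‖ofCoord (expCoord n c) (fun i => (hasPrim_expCoord n c i).memLp_two) x 0‖ ^ 2 +
        ‖ofCoord (expCoord n c) (fun i => (hasPrim_expCoord n c i).memLp_two) x 1‖ ^ 2 =
        Real.pi⁻¹ * (‖c 0‖ ^ 2 + ‖c 1‖ ^ 2) := by
      filter_upwards [ofCoord_ae (expCoord n c) fun i => (hasPrim_expCoord n c i).memLp_two]
        with x hx
      rw [hx, hx]
      simp only [expCoord, Matrix.cons_val_zero, Matrix.cons_val_one, norm_mul, norm_exp_int,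
        norm_exp_neg_int, norm_inv, Complex.norm_real, Real.norm_eq_abs, mul_one, mul_pow, inv_pow,
        sq_abs, hs]
      ring
    rw [integral_congr_ae this]
    simp only [integral_const, measureReal_univ, smul_eq_mul]
    field_simp

theorem expIso_ae (n : ℤ) (c : C2) : ∀ᵐ x ∂intervalMeasure, ∀ i,
    expIso n c x i = expCoord n c i x :=
  ofCoord_ae (expCoord n c) fun i => (hasPrim_expCoord n c i).memLp_two

theorem expIso_mem_graph (n : ℤ) (c : C2) :
    (expIso n c, ((n : ℝ) : ℂ) • expIso n c) ∈ (freeOp (bcOf n)).graph := by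
  refine mem_graph_iff.2 ⟨expCoord n c, _, ⟨hasPrim_expCoord n c, fun i => ?_, fun i => ?_,
    fun i => (expIso_ae n c).mono fun x hx => hx i⟩, ?_, ?_⟩
  · fin_cases i
    · exact (hasPrim_expCoord n c 0).memLp_two.const_mul _
    · exact (hasPrim_expCoord n c 1).memLp_two.const_mul _
  · fin_cases i
    · have := exp_int_mul_pi (-n)
      rw [bcOf_neg] at this
      rw [Int.cast_neg, mul_neg, ← neg_mul] at this
      change _ * Complex.exp (-Complex.I * n * Real.pi) =
        _ * (_ * Complex.exp (-Complex.I * n * (0 : ℝ)))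
      rw [this, Complex.ofReal_zero, mul_zero, Complex.exp_zero]
      ring
    · have := exp_int_mul_pi n
      change _ * Complex.exp (Complex.I * n * Real.pi) =
        _ * (_ * Complex.exp (Complex.I * n * (0 : ℝ)))
      rw [this, Complex.ofReal_zero, mul_zero, Complex.exp_zero]
      ring
  · filter_upwards [expIso_ae n c, coord_smul ((n : ℝ) : ℂ) (expIso n c), coeFn_zero_Lp]
      with x h1 h2 h3
    rw [h2, h1, h3, Complex.ofReal_intCast]
    simp only [Matrix.cons_val_zero]
    linear_combination (n * expCoord n c 0 x) * Complex.I_mul_I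
  · filter_upwards [expIso_ae n c, coord_smul ((n : ℝ) : ℂ) (expIso n c), coeFn_zero_Lp]
      with x h1 h2 h3
    rw [h2, h1, h3, Complex.ofReal_intCast]
    change _ = -(Complex.I * (Complex.I * n * expCoord n c 1 x)) + _
    linear_combination (n * expCoord n c 1 x) * Complex.I_mul_I

/-- Orthogonality to the eigenspace at `n`, in terms of Fourier coefficients. -/
theorem integral_exp_eq_zero {n : ℤ} {y : L2} (h : ∀ c, inner ℂ (expIso n c) y = 0) :
    ∫ x, Complex.exp (Complex.I * n * x) * y x 0 ∂intervalMeasure = 0 ∧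
    ∫ x, Complex.exp (-Complex.I * n * x) * y x 1 ∂intervalMeasure = 0 := by
  have hs0 : (((Real.sqrt Real.pi)⁻¹ : ℝ) : ℂ) ≠ 0 := by
    exact_mod_cast inv_ne_zero (Real.sqrt_pos.2 Real.pi_pos).ne'
  have hconj (x : ℝ) : (starRingEnd ℂ) (Complex.exp (-Complex.I * n * x)) =
      Complex.exp (Complex.I * n * x) := by
    rw [← Complex.exp_conj]; simp
  have hconj' (x : ℝ) : (starRingEnd ℂ) (Complex.exp (Complex.I * n * x)) =
      Complex.exp (-Complex.I * n * x) := by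
    rw [← Complex.exp_conj]; simp
  constructor
  · have h1 := h !₂[1, 0]
    rw [L2.inner_def] at h1
    refine (mul_eq_zero.1 (?_ : (((Real.sqrt Real.pi)⁻¹ : ℝ) : ℂ) * _ = 0)).resolve_left hs0
    rw [← h1, ← integral_const_mul]
    refine integral_congr_ae ?_
    filter_upwards [expIso_ae n !₂[1, 0]] with x hx
    simp only [PiLp.inner_apply, Fin.sum_univ_two, RCLike.inner_apply, hx]
    simp only [expCoord, Matrix.cons_val_zero, Matrix.cons_val_one, map_mul, hconj,
      Complex.conj_ofReal, map_one, map_zero]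
    ring
  · have h1 := h !₂[0, 1]
    rw [L2.inner_def] at h1
    refine (mul_eq_zero.1 (?_ : (((Real.sqrt Real.pi)⁻¹ : ℝ) : ℂ) * _ = 0)).resolve_left hs0
    rw [← h1, ← integral_const_mul]
    refine integral_congr_ae ?_
    filter_upwards [expIso_ae n !₂[0, 1]] with x hx
    simp only [PiLp.inner_apply, Fin.sum_univ_two, RCLike.inner_apply, hx]
    simp only [expCoord, Matrix.cons_val_zero, Matrix.cons_val_one, map_mul, hconj',
      Complex.conj_ofReal, map_one, map_zero]
    ring

/-- On the orthogonal complement of the eigenspace at `n`, the operator `L⁰ - n` is onto. -/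
theorem freeOp_solvable {n : ℤ} {f : L2} (h : ∀ c, inner ℂ (expIso n c) f = 0) :
    ∃ y, (y, f + ((n : ℝ) : ℂ) • y) ∈ (freeOp (bcOf n)).graph := by
  obtain ⟨h0, h1⟩ := integral_exp_eq_zero h
  have hint (i : Fin 2) : Integrable (fun x => f x i) intervalMeasure :=
    (memLp_coord f i).integrable (by norm_num)
  obtain ⟨a, ha, ha0, ha1⟩ := HasPrim.exists_solution (n : ℂ) 0 (hint 0)
  obtain ⟨b, hb, hb0, hb1⟩ := HasPrim.exists_solution (-(n : ℂ)) 0 (hint 1).neg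
  rw [h0] at ha1
  have h1' : ∫ x, Complex.exp (Complex.I * -(n : ℂ) * x) * (-fun x => f x 1) x
      ∂intervalMeasure = 0 := by
    rw [← neg_eq_zero, ← integral_neg, ← h1]
    refine integral_congr_ae (Filter.Eventually.of_forall fun x => ?_)
    simp
  rw [h1'] at hb1
  obtain ⟨y, hy, -⟩ := mem_freeOp_graph (bc := bcOf n) ha hb (by rw [ha1, ha0]; simp)
    (by rw [hb1, hb0]; simp)
  exact ⟨y, by rwa [Complex.ofReal_intCast]⟩

/-- A crude Poincaré inequality for functions of mean zero. -/
theorem HasPrim.poincare {u g : ℝ → ℂ} (H : HasPrim u g) (hg : MemLp g 2 intervalMeasure)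
    (h0 : ∫ x, u x ∂intervalMeasure = 0) :
    ∫ x, ‖u x‖ ^ 2 ∂intervalMeasure ≤ Real.pi ^ 2 * ∫ x, ‖g x‖ ^ 2 ∂intervalMeasure := by
  set m := ∫ x, ‖g x‖ ∂intervalMeasure with hm
  have hui := ContinuousOn.integrable_intervalMeasure H.continuousOn
  have hg2 := integrable_norm_sq hg
  have hpt : ∀ x ∈ Icc 0 Real.pi, ‖u x‖ ≤ m := by
    intro x hx
    have e : (Real.pi : ℂ) * u x = ∫ s, (u x - u s) ∂intervalMeasure := by
      rw [integral_sub (integrable_const _) hui, h0, sub_zero, integral_const, measureReal_univ,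
        Complex.real_smul]
    have h1 : ‖∫ s, (u x - u s) ∂intervalMeasure‖ ≤ Real.pi * m := by
      refine (norm_integral_le_integral_norm _).trans ?_
      have : ∫ s, ‖u x - u s‖ ∂intervalMeasure ≤ ∫ _, m ∂intervalMeasure := by
        refine integral_mono_ae ((integrable_const _).sub hui).norm (integrable_const _) ?_
        filter_upwards [ae_mem_Icc] with s hs using H.norm_sub_le hx hs
      rwa [integral_const, measureReal_univ, smul_eq_mul] at this
    rw [← e, norm_mul, Complex.norm_real, Real.norm_of_nonneg Real.pi_pos.le] at h1
    exact le_of_mul_le_mul_left h1 Real.pi_pos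
  -- `m² ≤ π ∫ |g|²`, since `∫ (|g| - m / π)² ≥ 0`
  have hcs : m ^ 2 ≤ Real.pi * ∫ x, ‖g x‖ ^ 2 ∂intervalMeasure := by
    have h1 : 0 ≤ ∫ x, (‖g x‖ - m / Real.pi) ^ 2 ∂intervalMeasure :=
      integral_nonneg fun x => sq_nonneg _
    have h2 : ∫ x, (‖g x‖ - m / Real.pi) ^ 2 ∂intervalMeasure =
        ∫ x, (‖g x‖ ^ 2 - (2 * (m / Real.pi)) * ‖g x‖ + (m / Real.pi) ^ 2) ∂intervalMeasure := by
      congr 1; ext x; ring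
    have hsub : Integrable (fun x => ‖g x‖ ^ 2 - (2 * (m / Real.pi)) * ‖g x‖) intervalMeasure :=
      hg2.sub (H.integrable.norm.const_mul _)
    rw [h2, integral_add hsub (integrable_const _),
      integral_sub hg2 (H.integrable.norm.const_mul _), integral_const_mul, integral_const,
      measureReal_univ, smul_eq_mul, ← hm] at h1
    have h3 : Real.pi * (m / Real.pi) ^ 2 = m ^ 2 / Real.pi := by
      field_simp
    have h4 : 2 * (m / Real.pi) * m = 2 * (m ^ 2 / Real.pi) := by ring
    rw [h3, h4] at h1
    have h5 : m ^ 2 / Real.pi ≤ ∫ x, ‖g x‖ ^ 2 ∂intervalMeasure := by linarith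
    rw [div_le_iff₀ Real.pi_pos] at h5
    linarith
  have h6 : ∫ x, ‖u x‖ ^ 2 ∂intervalMeasure ≤ ∫ _, m ^ 2 ∂intervalMeasure := by
    refine integral_mono_ae (integrable_norm_sq H.memLp_two) (integrable_const _) ?_
    filter_upwards [ae_mem_Icc] with x hx
    have := hpt x hx
    gcongr
  rw [integral_const, measureReal_univ, smul_eq_mul] at h6
  nlinarith [mul_le_mul_of_nonneg_left hcs Real.pi_pos.le]

/-- The spectral gap of the free operator around `n`. Multiplying the coordinates by `e^{±inx}`
reduces it to the Poincaré inequality, whose constant `π` is below `10 / 3`. -/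
theorem freeOp_gap {n : ℤ} {y f : L2} (hyf : (y, f) ∈ (freeOp (bcOf n)).graph)
    (h : ∀ c, inner ℂ (expIso n c) y = 0) : 3 / 10 * ‖y‖ ≤ ‖f - ((n : ℝ) : ℂ) • y‖ := by
  obtain ⟨u, g, H⟩ := mem_graph_iff.1 hyf
  obtain ⟨h0, h1⟩ := integral_exp_eq_zero h
  set F := f - ((n : ℝ) : ℂ) • y with hF
  have hFae := coord_sub f (((n : ℝ) : ℂ) • y)
  have hyae := coord_smul ((n : ℝ) : ℂ) y
  have hu := ae_all_iff.2 H.ae_eq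
  have key (i : Fin 2) (a s : ℂ) (hE : ∀ x : ℝ, ‖Complex.exp (a * x)‖ = 1)
      (hs : ‖s‖ = 1) (hder : ∀ᵐ x ∂intervalMeasure, a * u i x + g i x = s * F x i)
      (hint : ∫ x : ℝ, Complex.exp (a * x) * y x i ∂intervalMeasure = 0) :
      ∫ x, ‖y x i‖ ^ 2 ∂intervalMeasure ≤ Real.pi ^ 2 * ∫ x, ‖F x i‖ ^ 2 ∂intervalMeasure := by
    have hw := ((HasPrim.exp a).mul (H.prim i))
    have hwd : (fun x : ℝ => a * Complex.exp (a * x) * u i x + Complex.exp (a * x) * g i x)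
        =ᵐ[intervalMeasure] fun x => Complex.exp (a * x) * (s * F x i) := by
      filter_upwards [hder] with x hx
      rw [← hx]; ring
    have hw2 := hw.congr_deriv hwd
    have hmem : MemLp (fun x : ℝ => Complex.exp (a * x) * (s * F x i)) 2 intervalMeasure :=
      ((memLp_coord F i).const_mul s).mul (HasPrim.exp a).memLp_top (r := 2)
    have hint2 : ∫ x : ℝ, Complex.exp (a * x) * u i x ∂intervalMeasure = 0 := by
      rw [← hint]
      refine integral_congr_ae ?_
      filter_upwards [H.ae_eq i] with x hx
      rw [hx]
    have hP := hw2.poincare hmem hint2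
    simp only [norm_mul, hE, hs, one_mul] at hP
    refine le_trans (le_of_eq ?_) hP
    refine integral_congr_ae ?_
    filter_upwards [H.ae_eq i] with x hx
    rw [hx]
  have k0 := key 0 (Complex.I * n) (-Complex.I) (norm_exp_int n) (by simp) (by
    filter_upwards [H.free, hFae, hyae, hu] with x h2 h3 h4 h5
    rw [h2.1, hF, h3, h4, h5, Complex.ofReal_intCast]; ring) h0
  have k1 := key 1 (-Complex.I * n) Complex.I (norm_exp_neg_int n) (by simp) (by
    filter_upwards [H.free, hFae, hyae, hu] with x h2 h3 h4 h5
    rw [h2.2, hF, h3, h4, h5, Complex.ofReal_intCast]; ring) h1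
  have hy2 : ‖y‖ ^ 2 ≤ Real.pi ^ 2 * ‖F‖ ^ 2 := by
    rw [norm_sq_L2, norm_sq_L2, integral_add (integrable_norm_sq (memLp_coord y 0))
      (integrable_norm_sq (memLp_coord y 1)), integral_add (integrable_norm_sq (memLp_coord F 0))
      (integrable_norm_sq (memLp_coord F 1))]
    linarith
  have h3 : ‖y‖ ≤ Real.pi * ‖F‖ := by
    refine abs_le_of_sq_le_sq' ?_ (by positivity) |>.2
    rwa [mul_pow]
  nlinarith [Real.pi_lt_d2, norm_nonneg F]

/-! ### The two eigenvalues near a large integer -/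

/-- For large `|n|` there are exactly two eigenvalues near `n`, with multiplicity: they are the
eigenvalues of the restriction of the operator to its two-dimensional invariant subspace. -/
theorem eventually_exists_isEigenPair (v : Potential) :
    ∃ N : ℕ, ∀ n : ℤ, (N : ℤ) < |n| → ∃ lm lp : ℂ, IsEigenPair v n lm lp := by
  -- this `τ` makes `V` relatively bounded by `1 / 2` on the line `im z = τ`
  set τ : ℝ := max 1 (20 * v.distSq ⟨0, 0⟩) with hτ
  have hτ1 : 1 ≤ τ := le_max_left _ _
  have hτ2 : 20 * v.distSq ⟨0, 0⟩ ≤ τ := le_max_right _ _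
  have hτ0 : 0 < τ := one_pos.trans_le hτ1
  -- the resolvents are then within `1 / (100 τ²)`, twice the bound on the sandwiched potential
  obtain ⟨N, hN⟩ := eventually_sandwich_small v (ε := 1 / (200 * τ ^ 2)) (by positivity)
  refine ⟨N, fun n hn => ?_⟩
  set z₀ : ℂ := ((n : ℝ) : ℂ) + Complex.I * τ with hz₀
  have him : z₀.im = τ := by simp [hz₀]
  have hre : z₀.re = n := by simp [hz₀]
  have himabs : |z₀.im| = τ := by rw [him, abs_of_pos hτ0]
  have hz1 : 1 ≤ |z₀.im| := by rwa [himabs]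
  have hz2 : 20 * v.distSq ⟨0, 0⟩ ≤ |z₀.im| := by rwa [himabs]
  have hzN : (N : ℝ) < ‖z₀‖ := by
    refine lt_of_lt_of_le ?_ (Complex.abs_re_le_norm z₀)
    rw [hre]
    exact_mod_cast hn
  obtain ⟨R₀, hR₀, hR₀b⟩ := (freeOp_isSelfAdjoint (bcOf n)).2 z₀ (by rw [him]; exact hτ0.ne')
  have hR₀c : ∀ f, ‖R₀ f‖ ≤ ‖f‖ := fun f => by
    have := hR₀b f
    nlinarith [mul_le_mul_of_nonneg_right hz1 (norm_nonneg (R₀ f))]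
  obtain ⟨R, hR, hRR₀⟩ := exists_isInverse_of_perturbation (T := diracOp (bcOf n) v) hR₀ rfl
    (fun y f₀ f h₀ hf => norm_sub_le_half hz1 hz2 h₀ hf)
  have hclose := hRR₀ _ (hN (bcOf n) z₀ R₀ hzN hz1 hR₀ hR₀c)
  obtain ⟨Φ, C, hΦ, hC, hball, hquot⟩ := exists_invariant_subspace (isSymm_freeOp (bcOf n))
    (expIso n) (expIso_mem_graph n) (fun y f hyf h => freeOp_gap hyf h)
    (fun f h => freeOp_solvable h) hτ1 hR₀ hR (fun x => (hclose x).trans (le_of_eq (by ring)))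
  rw [Complex.ofReal_intCast] at hball hquot
  have hmult : ∀ z ∈ Metric.ball (n : ℂ) (1 / 4),
      algMult (diracOp (bcOf n) v) z = (C.charpoly.rootMultiplicity z : ℕ) := fun z hz =>
    algMult_eq_rootMultiplicity hΦ hC (hquot z hz)
  have hcard : Multiset.card C.charpoly.roots = 2 := by
    have h1 : C.charpoly.natDegree = 2 := by
      rw [LinearMap.charpoly_natDegree]; simp
    exact (Polynomial.splits_iff_card_roots.1 (IsAlgClosed.splits C.charpoly)).trans h1
  obtain ⟨a, b, hab⟩ := Multiset.card_eq_two.1 hcard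
  have hroot : ∀ z ∈ C.charpoly.roots, z ∈ Metric.ball (n : ℂ) (1 / 4) := fun z hz =>
    hball z ((Module.End.hasEigenvalue_iff_isRoot_charpoly C z).2
      (Polynomial.isRoot_of_mem_roots hz))
  have ha := hroot a (by rw [hab]; simp)
  have hb := hroot b (by rw [hab]; simp)
  have hpair : ∀ c d : ℂ, C.charpoly.roots = {c, d} → c ∈ Metric.ball (n : ℂ) (1 / 4) →
      d ∈ Metric.ball (n : ℂ) (1 / 4) → (c.re < d.re ∨ c.re = d.re ∧ c.im ≤ d.im) →
      IsEigenPair v n c d := by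
    intro c d hcd hc hd hord
    refine ⟨hc, hd, fun z hz => ?_, hord⟩
    rw [hmult z hz, ← Polynomial.count_roots, hcd]
  have hba : C.charpoly.roots = {b, a} := by rw [hab, Multiset.pair_comm]
  rcases lt_trichotomy a.re b.re with h | h | h
  · exact ⟨a, b, hpair a b hab ha hb (Or.inl h)⟩
  · rcases le_total a.im b.im with h' | h'
    · exact ⟨a, b, hpair a b hab ha hb (Or.inr ⟨h, h'⟩)⟩
    · exact ⟨b, a, hpair b a hba hb ha (Or.inr ⟨h.symm, h'⟩)⟩
  · exact ⟨b, a, hpair b a hba hb ha (Or.inl h)⟩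

theorem conjMap_eigenvector {t : ℝ} (ht : t < 0) {v : Potential} (hv : v ∈ classX t) {bc : BC}
    {y : L2} (hy : y ≠ 0) {z : ℂ} (h : (y, z • y) ∈ (diracOp bc v).graph) :
    conjMap t y ≠ 0 ∧
      (conjMap t y, (starRingEnd ℂ) z • conjMap t y) ∈ (diracOp bc v).graph := by
  refine ⟨fun h0 => ?_, ?_⟩
  · have h1 := conjMap_conjMap t y
    have h2 : conjMap t 0 = 0 := by
      have := conjMap_smul t 0 0
      simpa using this
    rw [h0, h2] at h1
    have ht' : (t : ℂ) ≠ 0 := by exact_mod_cast ht.ne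
    exact hy ((smul_eq_zero.1 h1.symm).resolve_left ht')
  · rw [← conjMap_smul]
    exact conjMap_mem_graph hv h

/-- A real eigenvalue has geometric multiplicity at least two: the antilinear symmetry maps its
eigenspace to itself and has no invariant line, since its square is the negative number `t`. -/
theorem two_le_geomMult {t : ℝ} (ht : t < 0) {v : Potential} (hv : v ∈ classX t) {bc : BC}
    {y : L2} (hy : y ≠ 0) {z : ℂ} (hz : (starRingEnd ℂ) z = z)
    (h : (y, z • y) ∈ (diracOp bc v).graph) : 2 ≤ geomMult (diracOp bc v) z := by
  obtain ⟨-, hJ⟩ := conjMap_eigenvector ht hv hy h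
  rw [hz] at hJ
  let y₁ : kerPow (diracOp bc v) z 1 := ⟨y, mem_kerPow_one.2 h⟩
  let y₂ : kerPow (diracOp bc v) z 1 := ⟨conjMap t y, mem_kerPow_one.2 hJ⟩
  have hli : LinearIndependent ℂ ![y₁, y₂] := by
    rw [LinearIndependent.pair_iff' (fun h0 => hy (congrArg Subtype.val h0))]
    intro a ha
    have ha' : a • y = conjMap t y := congrArg Subtype.val ha
    have h1 := conjMap_conjMap t y
    rw [← ha', conjMap_smul, ← ha', smul_smul, ← sub_eq_zero, ← sub_smul] at h1
    have h2 := sub_eq_zero.1 ((smul_eq_zero.1 h1).resolve_right hy)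
    rw [Complex.conj_mul'] at h2
    have h3 : ‖a‖ ^ 2 = t := by exact_mod_cast h2
    nlinarith [sq_nonneg ‖a‖]
  have := hli.cardinal_le_rank
  simpa [geomMult] using this

/-- For `t < 0` the antilinear symmetry leaves only two possibilities for the two eigenvalues near a
large integer. -/
theorem IsEigenPair.dichotomy {t : ℝ} (ht : t < 0) {v : Potential} (hv : v ∈ classX t) {n : ℤ}
    {lm lp : ℂ} (h : IsEigenPair v n lm lp) :
    (algMult (diracOp (bcOf n) v) lm = 1 ∧ algMult (diracOp (bcOf n) v) lp = 1 ∧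
        (starRingEnd ℂ) lp = lm ∧ lm.im ≠ 0 ∧ lp.im ≠ 0) ∨
      (lp = lm ∧ lp.im = 0 ∧ algMult (diracOp (bcOf n) v) lp = 2 ∧
        geomMult (diracOp (bcOf n) v) lp = 2) := by
  classical
  obtain ⟨hm, hp, hmult, -⟩ := h
  have hconj : ∀ z ∈ Metric.ball (n : ℂ) (1 / 4), algMult (diracOp (bcOf n) v) z ≠ 0 →
      (starRingEnd ℂ) z = lm ∨ (starRingEnd ℂ) z = lp := by
    intro z hz hz0
    obtain ⟨y, hy, hyg⟩ := exists_eigenvector hz0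
    obtain ⟨hJ0, hJ⟩ := conjMap_eigenvector ht hv hy hyg
    have hcz : (starRingEnd ℂ) z ∈ Metric.ball (n : ℂ) (1 / 4) := by
      rw [Metric.mem_ball, dist_eq_norm] at hz ⊢
      have : (starRingEnd ℂ) z - n = (starRingEnd ℂ) (z - n) := by simp
      rwa [this, RCLike.norm_conj]
    have h1 := algMult_ne_zero hJ0 hJ
    rw [hmult _ hcz] at h1
    have h2 : (starRingEnd ℂ) z ∈ ({lm, lp} : Multiset ℂ) := by
      rw [← Multiset.count_ne_zero]
      exact_mod_cast h1
    simpa using h2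
  by_cases heq : lp = lm
  · subst heq
    right
    have h2 : algMult (diracOp (bcOf n) v) lp = 2 := by
      rw [hmult _ hp]; simp
    have h0 : algMult (diracOp (bcOf n) v) lp ≠ 0 := by rw [h2]; norm_num
    have hreal : (starRingEnd ℂ) lp = lp := (hconj lp hp h0).elim id id
    obtain ⟨y, hy, hyg⟩ := exists_eigenvector h0
    refine ⟨rfl, Complex.conj_eq_iff_im.1 hreal, h2, le_antisymm ?_ ?_⟩
    · exact h2 ▸ geomMult_le_algMult _ _
    · exact two_le_geomMult ht hv hy hreal hyg
  · -- a real simple eigenvalue would have geometric multiplicity two, so `z` and `conj z` differ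
    left
    have h1m : algMult (diracOp (bcOf n) v) lm = 1 := by
      rw [hmult _ hm]; simp [Ne.symm heq]
    have h1p : algMult (diracOp (bcOf n) v) lp = 1 := by
      rw [hmult _ hp]; simp [heq]
    have hnonreal : ∀ z, algMult (diracOp (bcOf n) v) z = 1 → (starRingEnd ℂ) z ≠ z := by
      intro z hz hzr
      obtain ⟨y, hy, hyg⟩ := exists_eigenvector (T := diracOp (bcOf n) v) (z := z)
        (by rw [hz]; exact one_ne_zero)
      have := (two_le_geomMult ht hv hy hzr hyg).trans (geomMult_le_algMult _ _)
      rw [hz] at this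
      exact absurd this (by norm_num)
    have hnm := hnonreal lm h1m
    have hnp := hnonreal lp h1p
    refine ⟨h1m, h1p, ?_, fun h => hnm (Complex.conj_eq_iff_im.2 h),
      fun h => hnp (Complex.conj_eq_iff_im.2 h)⟩
    exact (hconj lp hp (by rw [h1p]; exact one_ne_zero)).resolve_right hnp

end PeriodicDirac

theorem mainTheorem10 (t : ℝ) (v : PeriodicDirac.Potential) (hv : v ∈ PeriodicDirac.classX t) :
    (0 < t → ∀ bc : PeriodicDirac.BC,
      (∃ T : PeriodicDirac.L2 →ₗ.[ℂ] PeriodicDirac.L2,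
        IsSelfAdjoint T ∧ PeriodicDirac.Similar (PeriodicDirac.diracOp bc v) T) ∧
      ∀ z ∈ PeriodicDirac.spectrum (PeriodicDirac.diracOp bc v), z.im = 0) ∧
    (t < 0 → ∃ N : ℕ, ∀ n : ℤ, (N : ℤ) < |n| →
      ∃ lm lp : ℂ, PeriodicDirac.IsEigenPair v n lm lp ∧
        ((PeriodicDirac.algMult (PeriodicDirac.diracOp (PeriodicDirac.bcOf n) v) lm = 1 ∧
          PeriodicDirac.algMult (PeriodicDirac.diracOp (PeriodicDirac.bcOf n) v) lp = 1 ∧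
          (starRingEnd ℂ) lp = lm ∧ lm.im ≠ 0 ∧ lp.im ≠ 0) ∨
         (lp = lm ∧ lp.im = 0 ∧
          PeriodicDirac.algMult (PeriodicDirac.diracOp (PeriodicDirac.bcOf n) v) lp = 2 ∧
          PeriodicDirac.geomMult (PeriodicDirac.diracOp (PeriodicDirac.bcOf n) v) lp = 2))) := by
  refine ⟨fun ht bc => PeriodicDirac.similar_selfAdjoint ht hv bc, fun ht => ?_⟩
  obtain ⟨N, hN⟩ := PeriodicDirac.eventually_exists_isEigenPair v
  refine ⟨N, fun n hn => ?_⟩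
  obtain ⟨lm, lp, h⟩ := hN n hn
  exact ⟨lm, lp, h, h.dichotomy ht hv⟩
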